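/- Let $\ell\ge 3$, $n=2^{\ell}-3$ and $m=\frac{n-1}{2}=2^{\ell-1}-2$. Let $k$ be a field of characteristic $2$ and let $R=k[x_1,\dots,x_n]$ with the standard grading. Let $I\subset R$ be a homogeneous ideal such that $R/I$ is an Artinian Gorenstein ring with Hilbert function $(1,n,n,1)$, i.e. $\dim_k (R/I)_j=1,n,n,1$ for $j=0,1,2,3$ and $\dim_k(R/I)_j=0$ for $j\ge 4$. Then $R/I$ has a minimal graded free resolution over $R$, and there is an integer $$a\in\Bigl\{0,\dots,\Bigl\lfloor \tfrac12\, n\tbinom{n}{m}\Bigr\rfloor-\tbinom{n}{m-1}-1\Bigr\}$$ such that the graded Betti numbers $\beta_{i,j}$ (the number of generators of degree $j$ of the $i$-th free module) of every minimal graded free resolution of $R/I$ satisfy the following: * $\beta_{m,m+2}=\beta_{m+1,m+2}=2a+1$; * $\beta_{0,0}=1$ and $\beta_{n,n+3}=1$; * $\beta_{i,i+1}=\beta_{n-i,\,n-i+2}$ for $1\le i\le n-1$; * $\beta_{i,j}=0$ unless $(i,j)=(0,0)$, or $1\le i\le n-1$ and $j\in\{i+1,i+2\}$, or $(i,j)=(n,n+3)$.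 In particular, the minimal graded free resolution of $R/I$ is not pure, i.e. there is no strictly increasing sequence of integers $\delta_0<\delta_1<\delta_2<\cdots$ with $\beta_{i,j}=0$ whenever $j\ne\delta_i$. -/

import Mathlib

attribute [local instance] MvPolynomial.gradedAlgebra

/-- A commutative ring is Gorenstein if it is Noetherian and its localization at every maximal
ideal has finite injective dimension as a module over itself. -/
def IsGorensteinRing (A : Type*) [CommRing A] : Prop :=
  IsNoetherianRing A ∧
    ∀ (p : Ideal A) [p.IsMaximal], ∃ d : ℕ,
      CategoryTheory.HasInjectiveDimensionLE
        (ModuleCat.of (Localization.AtPrime p) (Localization.AtPrime p)) d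

section GradedResolutions

variable {k : Type*} [Field k] {n : ℕ}

/-- The Hilbert function of `R ⧸ I`, where `R = k[x₁, …, xₙ]` has the standard grading: the
dimension over `k` of the image in `R ⧸ I` of the space of forms of degree `j`. -/
noncomputable def hilbertFunction (I : Ideal (MvPolynomial (Fin n) k)) (j : ℕ) : ℕ :=
  Module.finrank k
    ((MvPolynomial.homogeneousSubmodule (Fin n) k j).map (Ideal.Quotient.mkₐ k I).toLinearMap)

/-- `p` is homogeneous of degree `e ∈ ℤ`; for negative `e` this says that `p = 0`. -/
def IsFormOfDegree (p : MvPolynomial (Fin n) k) (e : ℤ) : Prop :=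
  ∀ u ∈ p.support, (u.degree : ℤ) = e

/-- A minimal graded free resolution
`0 ← R ⧸ I ← F₀ ← F₁ ← F₂ ← ⋯` over `R = k[x₁, …, xₙ]`, where `Fᵢ = ⨁ₐ R(-deg i a)` has
finite rank, the `a`-th standard basis vector of `Fᵢ` being of degree `deg i a`. -/
structure MinimalGradedFreeResolution (I : Ideal (MvPolynomial (Fin n) k)) where
  /-- the rank of `Fᵢ` -/
  rank : ℕ → ℕ
  /-- the degrees of the basis elements of `Fᵢ` -/
  deg : ∀ i, Fin (rank i) → ℤ
  /-- the augmentation `F₀ → R ⧸ I` -/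
  ε : (Fin (rank 0) → MvPolynomial (Fin n) k) →ₗ[MvPolynomial (Fin n) k]
    (MvPolynomial (Fin n) k ⧸ I)
  /-- the differential `Fᵢ₊₁ → Fᵢ` -/
  d : ∀ i, (Fin (rank (i + 1)) → MvPolynomial (Fin n) k) →ₗ[MvPolynomial (Fin n) k]
    (Fin (rank i) → MvPolynomial (Fin n) k)
  /-- the augmentation preserves degrees -/
  ε_graded : ∀ a, ∃ p : MvPolynomial (Fin n) k,
    IsFormOfDegree p (deg 0 a) ∧ ε (Pi.single a 1) = Ideal.Quotient.mk I p
  /-- the differentials preserve degrees -/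
  d_graded : ∀ i b a, IsFormOfDegree (d i (Pi.single b 1) a) (deg (i + 1) b - deg i a)
  ε_surjective : Function.Surjective ε
  exact_zero : Function.Exact (d 0) ε
  exact_succ : ∀ i, Function.Exact (d (i + 1)) (d i)
  /-- minimality: all entries of the matrices of the differentials lie in `(x₁, …, xₙ)` -/
  minimal : ∀ i b a, MvPolynomial.constantCoeff (d i (Pi.single b 1) a) = 0

namespace MinimalGradedFreeResolution

variable {I : Ideal (MvPolynomial (Fin n) k)}

/-- The graded Betti number `β_{i,j}`: the number of basis elements of `Fᵢ` of degree `j`. -/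
def betti (F : MinimalGradedFreeResolution I) (i : ℕ) (j : ℤ) : ℕ :=
  (Finset.univ.filter fun a => F.deg i a = j).card

/-- The resolution is pure: for some degree sequence `δ₀ < δ₁ < δ₂ < ⋯` one has `β_{i,j} = 0`
unless `j = δᵢ`. -/
def IsPure (F : MinimalGradedFreeResolution I) : Prop :=
  ∃ δ : ℕ → ℤ, StrictMono δ ∧ ∀ (i : ℕ) (j : ℤ), j ≠ δ i → F.betti i j = 0

end MinimalGradedFreeResolution

end GradedResolutions

/-! Write A = R/I and let K be the Koszul complex of A on the variables. The number β_{i,j} is the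
dimension of the homology of K in homological degree i and internal degree j
(`betti_eq_koszulRank`). It therefore does not depend on the resolution, so one integer a serves
them all.

The Gorenstein condition makes the socle of A one-dimensional, hence A_e × A_{3-e} → A_3 ≅ k is
perfect (`exists_isFrobenius`). With the pairing of Λ^p against Λ^{n-p} this gives a perfect pairing
of Koszul chains for which the differential is self-adjoint. So β_{i,j} = β_{n-i,n+3-j}
(`IsFrobenius.koszulRank_eq`). Independence of the variables in A_1 kills the homology with j ≤ i
for i ≥ 1, and duality then confines the Betti table to two rows and two corners.

In internal degree m+2 the complex reads A_1⊗Λ^{m+1} → A_2⊗Λ^m → A_3⊗Λ^{m-1}. The second map is dual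
to the injection A_0⊗Λ^{m+2} → A_1⊗Λ^{m+1}, so its rank is C(n,m-1). If r is the rank of the first
map, then β_{m,m+2} = n·C(n,m) - C(n,m-1) - r (`koszulRank_middle`). As n = 2m+1, the first map is
self-dual: r is the rank of the form ⟨df, g⟩ on A_1⊗Λ^{m+1}, which is alternating in characteristic
two, so r is even (`IsFrobenius.even_koszulDRank`). For n = 2^ℓ - 3, Lucas' theorem makes C(n,m)
even and C(n,m-1) odd (`parity_of_choose`). Hence β_{m,m+2} is odd; in particular it is nonzero, and
so is its dual β_{m+1,m+2}, which rules out purity.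

The upper bound on a comes from r ≥ C(n,m-1) (`choose_le_koszulDRank_middle`), an inequality that is
strict by parity. -/

open CategoryTheory Abelian

/-! ### Artinian Gorenstein local rings: self-injectivity and the socle. -/

namespace IsLocalRing
universe u
variable {A : Type u} [CommRing A] [IsLocalRing A]

/-- A module killed by the maximal ideal embeds into a free module as soon as the ring has a
nonzero element killed by the maximal ideal. -/
theorem exists_injective_finsupp_of_smul_eq_zero {s : A} (hs0 : s ≠ 0)
    (hs : ∀ a ∈ maximalIdeal A, a * s = 0) (Y : Type u) [AddCommGroup Y] [Module A Y]
    (hY : ∀ a ∈ maximalIdeal A, ∀ y : Y, a • y = 0) :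
    ∃ (ι : Type u) (f : Y →ₗ[A] (ι →₀ A)), Function.Injective f := by
  have hker : LinearMap.ker (LinearMap.toSpanSingleton A A s) = maximalIdeal A := by
    ext a
    rw [LinearMap.mem_ker, LinearMap.toSpanSingleton_apply, smul_eq_mul]
    refine ⟨fun h => ?_, hs a⟩
    by_contra hu
    rw [mem_maximalIdeal, mem_nonunits_iff, not_not] at hu
    exact hs0 (by simpa using (hu.mul_right_eq_zero).1 h)
  -- The socle element embeds the residue field into the ring; a vector space over that field then
  -- embeds coordinatewise.
  let e : (A ⧸ maximalIdeal A) →ₗ[A] A :=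
    (maximalIdeal A).liftQ (LinearMap.toSpanSingleton A A s) hker.ge
  have he : Function.Injective e := by
    rw [← LinearMap.ker_eq_bot]
    exact Submodule.ker_liftQ_eq_bot _ _ _ hker.le
  have ht : Module.IsTorsionBySet A Y (maximalIdeal A) := fun y a => hY a a.2 y
  let : Module (A ⧸ maximalIdeal A) Y := ht.module
  have : IsScalarTower A (A ⧸ maximalIdeal A) Y := ht.isScalarTower
  let : Field (A ⧸ maximalIdeal A) := Ideal.Quotient.field _
  let b := Module.Basis.ofVectorSpace (A ⧸ maximalIdeal A) Y
  refine ⟨_, (Finsupp.mapRange.linearMap e).comp (b.repr.toLinearMap.restrictScalars A), ?_⟩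
  exact (Finsupp.mapRange_injective _ (map_zero e) he).comp b.repr.injective

/-- Dévissage along 0 → 𝔪Y → Y → Y/𝔪Y → 0. The quotient Y/𝔪Y embeds into a free module F with some
cokernel C, so its Ext group in degree d+1 lies between that of F, which vanishes, and Ext in degree
d+2 of C, which vanishes by the injective dimension of X. Finite generation of Y plays no role. -/
theorem subsingleton_ext_of_smul_pow_eq_zero {s : A} (hs0 : s ≠ 0)
    (hs : ∀ a ∈ maximalIdeal A, a * s = 0) (X : ModuleCat.{u} A) (d : ℕ)
    (hX : HasInjectiveDimensionLE X (d + 1)) (i : ℕ) (Y : ModuleCat.{u} A)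
    (hY : ∀ a ∈ maximalIdeal A ^ i, ∀ y : Y, a • y = 0) :
    Subsingleton (Ext.{u} Y X (d + 1)) := by
  induction i generalizing Y with
  | zero =>
    have : Subsingleton Y := ⟨fun x y => by
      have h := fun z : Y => hY 1 (by simp) z
      simp only [one_smul] at h
      rw [h x, h y]⟩
    have hz : Limits.IsZero Y := ModuleCat.isZero_of_subsingleton Y
    refine ⟨fun e₁ e₂ => ?_⟩
    have h : ∀ e : Ext.{u} Y X (d + 1), e = 0 := fun e => by
      rw [← Ext.mk₀_id_comp e, hz.eq_zero_of_src (𝟙 Y), Ext.mk₀_zero, Ext.zero_comp]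
    rw [h e₁, h e₂]
  | succ i ih =>
    let N : Submodule A Y := maximalIdeal A • ⊤
    have hS := ModuleCat.shortComplex_shortExact
      (ModuleCat.shortComplexOfCompEqZero N.subtype N.mkQ
        (LinearMap.exact_subtype_mkQ N).linearMap_comp_eq_zero)
      (LinearMap.exact_subtype_mkQ N) N.injective_subtype N.mkQ_surjective
    have h1 : Subsingleton (Ext.{u} (ModuleCat.of A N) X (d + 1)) := by
      apply ih
      rintro a ha ⟨y, hy⟩
      ext
      change a • y = 0
      refine Submodule.smul_induction_on hy (fun r hr z _ => ?_) (fun u v hu hv => ?_)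
      · rw [smul_smul]
        exact hY _ (by rw [pow_succ]; exact Ideal.mul_mem_mul ha hr) z
      · rw [smul_add, hu, hv, add_zero]
    have h3 : Subsingleton (Ext.{u} (ModuleCat.of A (Y ⧸ N)) X (d + 1)) := by
      obtain ⟨ι, f, hf⟩ := exists_injective_finsupp_of_smul_eq_zero hs0 hs (Y ⧸ N) (by
        intro a ha y
        obtain ⟨y, rfl⟩ := N.mkQ_surjective y
        rw [← map_smul, Submodule.mkQ_apply, Submodule.Quotient.mk_eq_zero]
        exact Submodule.smul_mem_smul ha trivial)
      have hT := ModuleCat.shortComplex_shortExact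
        (ModuleCat.shortComplexOfCompEqZero f (LinearMap.range f).mkQ
          f.exact_map_mkQ_range.linearMap_comp_eq_zero)
        f.exact_map_mkQ_range hf (LinearMap.range f).mkQ_surjective
      refine ⟨fun e₁ e₂ => ?_⟩
      have h : ∀ e : Ext.{u} (ModuleCat.of A (Y ⧸ N)) X (d + 1), e = 0 := fun e => by
        have : Projective (ModuleCat.of A (ι →₀ A)) :=
          ModuleCat.projective_of_free (Module.Free.chooseBasis A (ι →₀ A))
        obtain ⟨φ, rfl⟩ := Ext.contravariant_sequence_exact₁ hT X e (add_comm 1 (d + 1))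
          (Ext.eq_zero_of_hasInjectiveDimensionLT _ (d + 2) (by omega))
        have : φ = 0 := Ext.eq_zero_of_projective (P := ModuleCat.of A (ι →₀ A)) φ
        rw [this, Ext.comp_zero]
      rw [h e₁, h e₂]
    refine ⟨fun e₁ e₂ => ?_⟩
    have h : ∀ e : Ext.{u} Y X (d + 1), e = 0 := fun e => by
      obtain ⟨φ, rfl⟩ := Ext.contravariant_sequence_exact₂ hS X e (h1.elim _ _)
      rw [h3.elim φ 0, Ext.comp_zero]
    rw [h e₁, h e₂]

/-- The maximal ideal is nilpotent, and its last nonzero power consists of socle elements. -/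
theorem exists_ne_zero_smul_maximalIdeal_eq_zero [IsArtinianRing A] :
    ∃ s : A, s ≠ 0 ∧ ∀ a ∈ maximalIdeal A, a * s = 0 := by
  obtain ⟨i, hi⟩ := (IsArtinianRing.isNilpotent_jacobson_bot (R := A))
  rw [IsLocalRing.jacobson_eq_maximalIdeal ⊥ bot_ne_top] at hi
  have hex : ∃ i, maximalIdeal A ^ i = 0 := ⟨i, hi⟩
  classical
  have h0 : Nat.find hex ≠ 0 := fun h => by
    have := Nat.find_spec hex
    rw [h, pow_zero] at this
    exact one_ne_zero this
  obtain ⟨l, hl⟩ := Nat.exists_eq_succ_of_ne_zero h0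
  have h1 : maximalIdeal A ^ l ≠ 0 := Nat.find_min hex (by omega)
  obtain ⟨s, hs, hs0⟩ := Submodule.exists_mem_ne_zero_of_ne_bot h1
  refine ⟨s, hs0, fun a ha => ?_⟩
  have := Nat.find_spec hex
  rw [hl, Nat.succ_eq_add_one, pow_succ'] at this
  have h2 := Ideal.mul_mem_mul ha hs
  rw [this] at h2
  exact h2

/-- An Artinian local ring of finite self-injective dimension is self-injective. -/
theorem injective_self_of_hasInjectiveDimensionLE [IsArtinianRing A] (d : ℕ)
    (h : HasInjectiveDimensionLE (ModuleCat.of A A) d) : Module.Injective A A := by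
  induction d with
  | zero =>
    rw [Module.injective_iff_injective_object]
    exact injective_iff_hasInjectiveDimensionLT_one.2 h
  | succ d ih =>
    apply ih
    obtain ⟨s, hs0, hs⟩ := exists_ne_zero_smul_maximalIdeal_eq_zero (A := A)
    obtain ⟨i, hi⟩ := (IsArtinianRing.isNilpotent_jacobson_bot (R := A))
    rw [IsLocalRing.jacobson_eq_maximalIdeal ⊥ bot_ne_top] at hi
    -- Since the maximal ideal is nilpotent, the dévissage covers every module, and the injective
    -- dimension drops by one.
    refine hasInjectiveDimensionLT_of_enoughProjectives _ _ fun Y =>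
      subsingleton_ext_of_smul_pow_eq_zero hs0 hs _ d h i Y fun a ha y => ?_
    rw [hi] at ha
    rw [show a = 0 from ha, zero_smul]

/-- The socle of a self-injective local ring is generated by each of its nonzero elements. -/
theorem exists_mul_eq_of_injective_self (h : Module.Injective A A) {s t : A} (hs0 : s ≠ 0)
    (ht0 : t ≠ 0) (hs : ∀ a ∈ maximalIdeal A, a * s = 0) (ht : ∀ a ∈ maximalIdeal A, a * t = 0) :
    ∃ a, t = a * s := by
  have key : ∀ {u : A}, u ≠ 0 → (∀ a ∈ maximalIdeal A, a * u = 0) →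
      LinearMap.ker (LinearMap.toSpanSingleton A A u) = maximalIdeal A := by
    intro u hu0 hu
    ext a
    rw [LinearMap.mem_ker, LinearMap.toSpanSingleton_apply, smul_eq_mul]
    refine ⟨fun h => ?_, hu a⟩
    by_contra hn
    rw [mem_maximalIdeal, mem_nonunits_iff, not_not] at hn
    exact hu0 (by simpa using (hn.mul_right_eq_zero).1 h)
  let e : (A ⧸ maximalIdeal A) →ₗ[A] A :=
    (maximalIdeal A).liftQ (LinearMap.toSpanSingleton A A s) (key hs0 hs).ge
  let e' : (A ⧸ maximalIdeal A) →ₗ[A] A :=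
    (maximalIdeal A).liftQ (LinearMap.toSpanSingleton A A t) (key ht0 ht).ge
  have he : Function.Injective e := by
    rw [← LinearMap.ker_eq_bot]
    exact Submodule.ker_liftQ_eq_bot _ _ _ (key hs0 hs).le
  -- Injectivity extends 1 ↦ t along 1 ↦ s to an endomorphism of A, which is multiplication by `g
  -- 1`.
  obtain ⟨g, hg⟩ := h.out e he e'
  have h1 := hg (Submodule.Quotient.mk 1)
  simp only [e, e', Submodule.liftQ_apply, LinearMap.toSpanSingleton_apply, one_smul] at h1
  refine ⟨g 1, ?_⟩
  rw [← h1, mul_comm, ← smul_eq_mul, ← map_smul, smul_eq_mul, mul_one]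

end IsLocalRing

/-- A local ring is its own localization at the maximal ideal, so the finite injective dimension
transfers back to the ring. -/
theorem IsGorensteinRing.exists_mul_eq {A : Type*} [CommRing A] [IsLocalRing A] [IsArtinianRing A]
    (hG : IsGorensteinRing A) {s t : A} (hs0 : s ≠ 0) (ht0 : t ≠ 0)
    (hs : ∀ a ∈ IsLocalRing.maximalIdeal A, a * s = 0)
    (ht : ∀ a ∈ IsLocalRing.maximalIdeal A, a * t = 0) :
    ∃ a, t = a * s := by
  obtain ⟨d, hd⟩ := hG.2 (IsLocalRing.maximalIdeal A)
  have hu : ∀ x ∈ (IsLocalRing.maximalIdeal A).primeCompl, IsUnit x := fun x hx => by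
    by_contra h
    exact hx h
  let eR : A ≃ₐ[A] Localization.AtPrime (IsLocalRing.maximalIdeal A) :=
    IsLocalization.atUnits A (IsLocalRing.maximalIdeal A).primeCompl hu
  let _ := RingHomInvPair.of_ringEquiv eR.toRingEquiv
  let _ := RingHomInvPair.of_ringEquiv eR.toRingEquiv.symm
  have := (ModuleCat.hasInjectiveDimensionLE_iff_of_semiLinearEquiv eR.toRingEquiv
    (M := ModuleCat.of A A)
    (N := ModuleCat.of _ (Localization.AtPrime (IsLocalRing.maximalIdeal A)))
    { eR.toRingEquiv.toAddEquiv with map_smul' := fun a b => map_mul eR a b } d).2 hd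
  exact IsLocalRing.exists_mul_eq_of_injective_self
    (IsLocalRing.injective_self_of_hasInjectiveDimensionLE d this) hs0 ht0 hs ht
open MvPolynomial


/-! ### Homogeneous forms with integer degrees and graded free modules. -/

section Forms

variable {k : Type*} [Field k] {n : ℕ}

theorem isFormOfDegree_iff {p : MvPolynomial (Fin n) k} {e : ℤ} :
    IsFormOfDegree p e ↔ ∀ u : Fin n →₀ ℕ, (u.degree : ℤ) ≠ e → coeff u p = 0 := by
  simp only [IsFormOfDegree, mem_support_iff]
  exact forall_congr' fun u => not_imp_comm

/-- The space of forms of degree `e ∈ ℤ`. -/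
def formsOfDegree (k : Type*) [Field k] (n : ℕ) (e : ℤ) :
    Submodule k (MvPolynomial (Fin n) k) where
  carrier := {p | IsFormOfDegree p e}
  zero_mem' := by simp [IsFormOfDegree]
  add_mem' {p q} hp hq := by
    rw [Set.mem_ofPred_eq, isFormOfDegree_iff] at *
    intro u hu
    rw [coeff_add, hp u hu, hq u hu, add_zero]
  smul_mem' c p hp := by
    rw [Set.mem_ofPred_eq, isFormOfDegree_iff] at *
    intro u hu
    rw [coeff_smul, hp u hu, smul_zero]

theorem mem_formsOfDegree {p : MvPolynomial (Fin n) k} {e : ℤ} :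
    p ∈ formsOfDegree k n e ↔ IsFormOfDegree p e := Iff.rfl

theorem formsOfDegree_natCast (e : ℕ) :
    formsOfDegree k n e = homogeneousSubmodule (Fin n) k e := by
  ext p
  rw [mem_formsOfDegree, isFormOfDegree_iff, mem_homogeneousSubmodule]
  constructor
  · intro h u hu
    rw [show (Finsupp.weight (1 : Fin n → ℕ)) u = u.degree from
      (congrFun (congrArg DFunLike.coe Finsupp.degree_eq_weight_one) u).symm]
    by_contra hne
    exact hu (h u (by exact_mod_cast hne))
  · intro h u hu
    exact h.coeff_eq_zero (by exact_mod_cast hu)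

theorem formsOfDegree_of_neg {e : ℤ} (he : e < 0) : formsOfDegree k n e = ⊥ := by
  refine (Submodule.eq_bot_iff _).2 fun p hp => ?_
  ext u
  exact isFormOfDegree_iff.1 hp u (by omega)

theorem IsFormOfDegree.mul {p q : MvPolynomial (Fin n) k} {d e : ℤ} (hp : IsFormOfDegree p d)
    (hq : IsFormOfDegree q e) : IsFormOfDegree (p * q) (d + e) := by
  rw [isFormOfDegree_iff] at *
  intro u hu
  rw [coeff_mul]
  refine Finset.sum_eq_zero fun x hx => ?_
  rw [Finset.HasAntidiagonal.mem_antidiagonal] at hx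
  by_cases h1 : (x.1.degree : ℤ) = d
  · rw [hq x.2 (fun h2 => hu ?_), mul_zero]
    rw [← hx, map_add, Nat.cast_add, h1, h2]
  · rw [hp _ h1, zero_mul]

theorem isFormOfDegree_X (s : Fin n) : IsFormOfDegree (X s : MvPolynomial (Fin n) k) 1 := by
  have h := (formsOfDegree_natCast (k := k) (n := n) 1).ge
    ((mem_homogeneousSubmodule 1 _).2 (isHomogeneous_X k s))
  exact (by simpa using h : X s ∈ formsOfDegree k n 1)

theorem isFormOfDegree_one : IsFormOfDegree (1 : MvPolynomial (Fin n) k) 0 := by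
  have h := (formsOfDegree_natCast (k := k) (n := n) 0).ge
    ((mem_homogeneousSubmodule 0 _).2 (isHomogeneous_one (Fin n) k))
  exact (by simpa using h : 1 ∈ formsOfDegree k n 0)

theorem isFormOfDegree_zero (e : ℤ) : IsFormOfDegree (0 : MvPolynomial (Fin n) k) e :=
  (formsOfDegree k n e).zero_mem

theorem IsFormOfDegree.X_mul {p : MvPolynomial (Fin n) k} {e : ℤ} (hp : IsFormOfDegree p e)
    (s : Fin n) : IsFormOfDegree (X s * p) (e + 1) := by
  rw [add_comm]
  exact (isFormOfDegree_X s).mul hp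

theorem IsFormOfDegree.eq_C {p : MvPolynomial (Fin n) k} (hp : IsFormOfDegree p 0) :
    p = C (constantCoeff p) := by
  ext u
  rw [coeff_C]
  split_ifs with h
  · rw [← h]; rfl
  · refine isFormOfDegree_iff.1 hp u fun h0 => h ?_
    exact ((Finsupp.degree_eq_zero_iff u).1 (by exact_mod_cast h0)).symm

theorem IsFormOfDegree.constantCoeff_eq_zero {p : MvPolynomial (Fin n) k} {e : ℤ}
    (hp : IsFormOfDegree p e) (he : e ≠ 0) : constantCoeff p = 0 :=
  isFormOfDegree_iff.1 hp 0 (by simpa using he.symm)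

/-- The homogeneous component of degree `e ∈ ℤ`. -/
noncomputable def formComponent (e : ℤ) :
    MvPolynomial (Fin n) k →ₗ[k] MvPolynomial (Fin n) k :=
  if 0 ≤ e then homogeneousComponent e.toNat else 0

theorem coeff_formComponent (e : ℤ) (p : MvPolynomial (Fin n) k) (u : Fin n →₀ ℕ) :
    coeff u (formComponent e p) = if (u.degree : ℤ) = e then coeff u p else 0 := by
  unfold formComponent
  split_ifs with h1 h2 h2
  · rw [coeff_homogeneousComponent, if_pos (by omega)]
  · rw [coeff_homogeneousComponent, if_neg (by omega)]
  · omega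
  · simp

theorem isFormOfDegree_formComponent (e : ℤ) (p : MvPolynomial (Fin n) k) :
    IsFormOfDegree (formComponent e p) e :=
  isFormOfDegree_iff.2 fun u hu => by rw [coeff_formComponent, if_neg hu]

theorem IsFormOfDegree.formComponent_eq {p : MvPolynomial (Fin n) k} {e : ℤ}
    (hp : IsFormOfDegree p e) : formComponent e p = p := by
  ext u
  rw [coeff_formComponent]
  split_ifs with h
  · rfl
  · exact (isFormOfDegree_iff.1 hp u h).symm

theorem IsFormOfDegree.formComponent_eq_zero {p : MvPolynomial (Fin n) k} {d e : ℤ}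
    (hp : IsFormOfDegree p d) (hde : d ≠ e) : formComponent e p = 0 := by
  ext u
  rw [coeff_formComponent, coeff_zero]
  split_ifs with h
  · exact isFormOfDegree_iff.1 hp u (h ▸ hde.symm)
  · rfl

theorem IsFormOfDegree.formComponent_mul {p : MvPolynomial (Fin n) k} {d : ℤ}
    (hp : IsFormOfDegree p d) (e : ℤ) (g : MvPolynomial (Fin n) k) :
    formComponent e (g * p) = formComponent (e - d) g * p := by
  ext u
  rw [coeff_formComponent, coeff_mul, coeff_mul]
  split_ifs with h
  · refine Finset.sum_congr rfl fun x hx => ?_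
    rw [Finset.HasAntidiagonal.mem_antidiagonal] at hx
    rw [coeff_formComponent]
    split_ifs with h1
    · rfl
    · rw [isFormOfDegree_iff.1 hp x.2 (fun h2 => h1 ?_), mul_zero, zero_mul]
      rw [← h, ← hx, map_add, Nat.cast_add, h2]
      ring
  · symm
    refine Finset.sum_eq_zero fun x hx => ?_
    rw [Finset.HasAntidiagonal.mem_antidiagonal] at hx
    rw [coeff_formComponent]
    split_ifs with h1
    · rw [isFormOfDegree_iff.1 hp x.2 (fun h2 => h ?_), mul_zero]
      rw [← hx, map_add, Nat.cast_add, h1, h2]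
      ring
    · rw [zero_mul]

theorem sum_formComponent (p : MvPolynomial (Fin n) k) :
    ∑ i ∈ Finset.range (p.totalDegree + 1), formComponent (i : ℤ) p = p := by
  conv_rhs => rw [← sum_homogeneousComponent p]
  refine Finset.sum_congr rfl fun i _ => ?_
  simp [formComponent]

theorem Ideal.IsHomogeneous.formComponent_mem {I : Ideal (MvPolynomial (Fin n) k)}
    (hI : I.IsHomogeneous (homogeneousSubmodule (Fin n) k)) {p : MvPolynomial (Fin n) k}
    (hp : p ∈ I) (e : ℤ) : formComponent e p ∈ I := by
  unfold formComponent
  split_ifs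
  · exact homogeneousComponent_mem_of_mem hI hp _
  · exact I.zero_mem

/-- The piece of degree `j` of the graded free module with a basis of the given degrees. -/
noncomputable def freeGraded {r : ℕ} (deg : Fin r → ℤ) (j : ℤ) :
    Submodule k (Fin r → MvPolynomial (Fin n) k) :=
  Submodule.pi Set.univ fun a => formsOfDegree k n (j - deg a)

theorem mem_freeGraded {r : ℕ} {deg : Fin r → ℤ} {j : ℤ} {g : Fin r → MvPolynomial (Fin n) k} :
    g ∈ freeGraded deg j ↔ ∀ a, IsFormOfDegree (g a) (j - deg a) := by
  simp [freeGraded, Submodule.mem_pi, mem_formsOfDegree]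

/-- The component of degree `j` in the graded free module with a basis of the given degrees. -/
noncomputable def freeComponent {r : ℕ} (deg : Fin r → ℤ) (j : ℤ) :
    (Fin r → MvPolynomial (Fin n) k) →ₗ[k] (Fin r → MvPolynomial (Fin n) k) :=
  LinearMap.pi fun a => (formComponent (j - deg a)).comp (LinearMap.proj a)

theorem freeComponent_apply {r : ℕ} (deg : Fin r → ℤ) (j : ℤ)
    (g : Fin r → MvPolynomial (Fin n) k) (a : Fin r) :
    freeComponent deg j g a = formComponent (j - deg a) (g a) := rfl

theorem freeComponent_mem {r : ℕ} (deg : Fin r → ℤ) (j : ℤ)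
    (g : Fin r → MvPolynomial (Fin n) k) : freeComponent deg j g ∈ freeGraded deg j :=
  mem_freeGraded.2 fun _ => isFormOfDegree_formComponent _ _

theorem freeComponent_of_mem {r : ℕ} {deg : Fin r → ℤ} {j : ℤ}
    {g : Fin r → MvPolynomial (Fin n) k} (hg : g ∈ freeGraded deg j) :
    freeComponent deg j g = g :=
  funext fun a => (mem_freeGraded.1 hg a).formComponent_eq

theorem LinearMap.apply_eq_sum_single {R M : Type*} [CommSemiring R] [AddCommMonoid M] [Module R M]
    {r : ℕ} (φ : (Fin r → R) →ₗ[R] M) (g : Fin r → R) :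
    φ g = ∑ b, g b • φ (Pi.single b 1) := by
  conv_lhs => rw [← LinearMap.sum_single_apply (fun _ => R) g, map_sum]
  refine Finset.sum_congr rfl fun b _ => ?_
  rw [← map_smul]
  congr 1
  ext c
  simp [Pi.single_apply]

/-- A map of free modules given by a matrix of forms of the right degrees respects components. -/
theorem formComponent_of_graded {r : ℕ} {deg : Fin r → ℤ}
    {φ : (Fin r → MvPolynomial (Fin n) k) →ₗ[MvPolynomial (Fin n) k] MvPolynomial (Fin n) k}
    {c : ℤ} (hφ : ∀ b, IsFormOfDegree (φ (Pi.single b 1)) (deg b - c)) (j : ℤ)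
    (g : Fin r → MvPolynomial (Fin n) k) :
    formComponent (j - c) (φ g) = φ (freeComponent deg j g) := by
  rw [φ.apply_eq_sum_single, φ.apply_eq_sum_single, map_sum]
  refine Finset.sum_congr rfl fun b _ => ?_
  rw [smul_eq_mul, smul_eq_mul, (hφ b).formComponent_mul, freeComponent_apply]
  congr 2
  ring_nf

theorem freeComponent_of_graded {r r' : ℕ} {deg : Fin r → ℤ} {deg' : Fin r' → ℤ}
    {φ : (Fin r → MvPolynomial (Fin n) k) →ₗ[MvPolynomial (Fin n) k]
      (Fin r' → MvPolynomial (Fin n) k)}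
    (hφ : ∀ b a, IsFormOfDegree (φ (Pi.single b 1) a) (deg b - deg' a)) (j : ℤ)
    (g : Fin r → MvPolynomial (Fin n) k) :
    freeComponent deg' j (φ g) = φ (freeComponent deg j g) := by
  ext1 a
  exact formComponent_of_graded (φ := (LinearMap.proj a).comp φ) (fun b => hφ b a) j g

theorem map_mem_freeGraded {r r' : ℕ} {deg : Fin r → ℤ} {deg' : Fin r' → ℤ}
    {φ : (Fin r → MvPolynomial (Fin n) k) →ₗ[MvPolynomial (Fin n) k]
      (Fin r' → MvPolynomial (Fin n) k)}
    (hφ : ∀ b a, IsFormOfDegree (φ (Pi.single b 1) a) (deg b - deg' a)) {j : ℤ}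
    {g : Fin r → MvPolynomial (Fin n) k} (hg : g ∈ freeGraded deg j) :
    φ g ∈ freeGraded deg' j := by
  rw [← freeComponent_of_mem hg, ← freeComponent_of_graded hφ]
  exact freeComponent_mem _ _ _

theorem sum_freeComponent {r : ℕ} (deg : Fin r → ℤ) (g : Fin r → MvPolynomial (Fin n) k) :
    ∃ s : Finset ℤ, ∑ j ∈ s, freeComponent deg j g = g := by
  classical
  -- The coordinates carry different degree shifts, so the relevant degrees are collected coordinate
  -- by coordinate.
  let T : Fin r → Finset ℤ := fun a =>
    (Finset.range ((g a).totalDegree + 1)).image fun i : ℕ => (i : ℤ) + deg a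
  refine ⟨Finset.univ.biUnion T, ?_⟩
  ext1 a
  rw [Finset.sum_apply]
  have hsub : T a ⊆ Finset.univ.biUnion T := Finset.subset_biUnion_of_mem T (Finset.mem_univ a)
  rw [← Finset.sum_subset hsub]
  · rw [Finset.sum_image (fun x _ y _ h => by simpa using h)]
    conv_rhs => rw [← sum_formComponent (g a)]
    refine Finset.sum_congr rfl fun i _ => ?_
    rw [freeComponent_apply, add_sub_cancel_right]
  · intro j _ hj
    rw [freeComponent_apply]
    ext u
    rw [coeff_formComponent, coeff_zero]
    split_ifs with h
    · by_contra hne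
      refine hj (Finset.mem_image.2 ⟨u.degree, ?_, by omega⟩)
      rw [Finset.mem_range, Nat.lt_succ_iff]
      have := le_totalDegree (mem_support_iff.2 hne)
      exact this
    · rfl

end Forms

/-! ### The Koszul complex in characteristic two. -/

section Koszul

variable {k : Type*} [Field k] {n : ℕ}
variable {M : Type*} [AddCommGroup M]


section Chains

variable [Module k M]

/-- The Koszul chains of homological degree `p` and internal degree `j`, for a family of spaces
that is thought of as the homogeneous pieces of a graded module. -/
def koszulChains (L : ℤ → Submodule k M) (p : ℕ) (j : ℤ) : Submodule k (Finset (Fin n) → M) :=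
  Submodule.pi Set.univ fun S => if S.card = p then L (j - p) else ⊥

theorem mem_koszulChains {L : ℤ → Submodule k M} {p : ℕ} {j : ℤ} {f : Finset (Fin n) → M} :
    f ∈ koszulChains L p j ↔ ∀ S, (S.card = p → f S ∈ L (j - p)) ∧ (S.card ≠ p → f S = 0) := by
  simp only [koszulChains, Submodule.mem_pi, Set.mem_univ, true_imp_iff]
  refine forall_congr' fun S => ?_
  split_ifs with h <;> simp [h]

theorem apply_eq_zero_of_mem_koszulChains {L : ℤ → Submodule k M} {p : ℕ} {j : ℤ}
    {f : Finset (Fin n) → M} (hf : f ∈ koszulChains L p j) {S : Finset (Fin n)}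
    (hS : S.card ≠ p) : f S = 0 := (mem_koszulChains.1 hf S).2 hS

theorem koszulChains_mono {L L' : ℤ → Submodule k M} (h : ∀ e, L e ≤ L' e) (p : ℕ) (j : ℤ) :
    (koszulChains L p j : Submodule k (Finset (Fin n) → M)) ≤ koszulChains L' p j :=
  fun _ hf => mem_koszulChains.2 fun S =>
    ⟨fun hS => h _ ((mem_koszulChains.1 hf S).1 hS), (mem_koszulChains.1 hf S).2⟩

end Chains

variable [Module (MvPolynomial (Fin n) k) M]

/-- The Koszul differential on `M ⊗ Λ(k^n)`, whose elements are written as functions on the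
subsets of the index set. The signs are omitted, which is harmless in characteristic two. -/
noncomputable def koszulD (k : Type*) [Field k] (n : ℕ) (M : Type*) [AddCommGroup M]
    [Module (MvPolynomial (Fin n) k) M] :
    (Finset (Fin n) → M) →ₗ[MvPolynomial (Fin n) k] (Finset (Fin n) → M) where
  toFun f T := ∑ s ∈ Tᶜ, (X s : MvPolynomial (Fin n) k) • f (insert s T)
  map_add' f g := by
    ext T
    simp [Finset.sum_add_distrib]
  map_smul' c f := by
    ext T
    simp only [Pi.smul_apply, RingHom.id_apply, Finset.smul_sum]
    exact Finset.sum_congr rfl fun s _ => smul_comm _ _ _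

theorem koszulD_apply (f : Finset (Fin n) → M) (T : Finset (Fin n)) :
    koszulD k n M f T = ∑ s ∈ Tᶜ, (X s : MvPolynomial (Fin n) k) • f (insert s T) := rfl

/-- Removing s and then t gives the same term as t and then s; without signs the two cancel because
2 = 0. -/
theorem koszulD_koszulD [CharP k 2] (f : Finset (Fin n) → M) :
    koszulD k n M (koszulD k n M f) = 0 := by
  ext T
  rw [koszulD_apply, Pi.zero_apply]
  simp only [koszulD_apply, Finset.smul_sum]
  rw [Finset.sum_sigma']
  have h2 : ∀ m : M, m + m = 0 := fun m => by
    rw [← two_smul (MvPolynomial (Fin n) k) m, CharTwo.two_eq_zero, zero_smul]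
  refine Finset.sum_involution (fun x _ => ⟨x.2, x.1⟩) ?_ ?_ ?_ ?_
  · rintro ⟨s, t⟩ _
    simp only
    rw [Finset.insert_comm, smul_comm]
    exact h2 _
  · rintro ⟨s, t⟩ h _ h'
    simp only [Finset.mem_sigma, Finset.mem_compl, Finset.mem_insert, not_or] at h
    simp only [Sigma.mk.injEq] at h'
    exact h.2.1 h'.1
  · rintro ⟨s, t⟩ h
    simp only [Finset.mem_sigma, Finset.mem_compl, Finset.mem_insert, not_or] at h ⊢
    exact ⟨h.2.2, fun h' => h.2.1 h'.symm, h.1⟩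
  · rintro ⟨s, t⟩ _
    rfl

theorem koszulD_comp {M' : Type*} [AddCommGroup M'] [Module (MvPolynomial (Fin n) k) M']
    (φ : M →ₗ[MvPolynomial (Fin n) k] M') (f : Finset (Fin n) → M) :
    koszulD k n M' (fun S => φ (f S)) = fun S => φ (koszulD k n M f S) := by
  ext T
  simp only [koszulD_apply, map_sum, map_smul]

variable [Module k M]

/-- The variables raise degrees by one. -/
def RespectsDegrees (n : ℕ) {M : Type*} [AddCommGroup M] [Module (MvPolynomial (Fin n) k) M]
    [Module k M] (L : ℤ → Submodule k M) : Prop :=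
  ∀ (e : ℤ) (s : Fin n), ∀ m ∈ L e, (X s : MvPolynomial (Fin n) k) • m ∈ L (e + 1)

theorem koszulD_mem_koszulChains {L : ℤ → Submodule k M} (hL : RespectsDegrees n L) {p : ℕ}
    {j : ℤ} {f : Finset (Fin n) → M} (hf : f ∈ koszulChains L (p + 1) j) :
    koszulD k n M f ∈ koszulChains L p j := by
  rw [mem_koszulChains] at *
  refine fun S => ⟨fun hS => ?_, fun hS => ?_⟩
  · rw [koszulD_apply]
    refine Submodule.sum_mem _ fun s hs => ?_
    have := hL _ s _ ((hf (insert s S)).1 (by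
      rw [Finset.card_insert_of_notMem (by simpa using hs), hS]))
    convert this using 2
    push_cast
    ring
  · rw [koszulD_apply]
    refine Finset.sum_eq_zero fun s hs => ?_
    rw [(hf (insert s S)).2, smul_zero]
    rw [Finset.card_insert_of_notMem (by simpa using hs)]
    omega

theorem koszulD_eq_zero_of_mem_koszulChains_zero {L : ℤ → Submodule k M} {j : ℤ}
    {f : Finset (Fin n) → M} (hf : f ∈ koszulChains L 0 j) : koszulD k n M f = 0 := by
  ext T
  rw [koszulD_apply]
  refine Finset.sum_eq_zero fun s hs => ?_
  rw [apply_eq_zero_of_mem_koszulChains hf, smul_zero]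
  rw [Finset.card_insert_of_notMem (by simpa using hs)]
  omega

variable [IsScalarTower k (MvPolynomial (Fin n) k) M]

/-- The Koszul cycles. -/
noncomputable def koszulCycles (L : ℤ → Submodule k M) (p : ℕ) (j : ℤ) :
    Submodule k (Finset (Fin n) → M) :=
  koszulChains L p j ⊓ LinearMap.ker ((koszulD k n M).restrictScalars k)

/-- The Koszul boundaries. -/
noncomputable def koszulBoundaries (L : ℤ → Submodule k M) (p : ℕ) (j : ℤ) :
    Submodule k (Finset (Fin n) → M) :=
  (koszulChains L (p + 1) j).map ((koszulD k n M).restrictScalars k)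

/-- The dimension of the Koszul homology. -/
noncomputable def koszulRank (n : ℕ) {M : Type*} [AddCommGroup M]
    [Module (MvPolynomial (Fin n) k) M] [Module k M]
    [IsScalarTower k (MvPolynomial (Fin n) k) M] (L : ℤ → Submodule k M) (p : ℕ) (j : ℤ) : ℕ :=
  Module.finrank k (koszulCycles (n := n) L p j ⧸
    (koszulBoundaries L p j).submoduleOf (koszulCycles (n := n) L p j))

theorem mem_koszulCycles {L : ℤ → Submodule k M} {p : ℕ} {j : ℤ} {f : Finset (Fin n) → M} :
    f ∈ koszulCycles L p j ↔ f ∈ koszulChains L p j ∧ koszulD k n M f = 0 := by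
  simp [koszulCycles]

theorem mem_koszulBoundaries {L : ℤ → Submodule k M} {p : ℕ} {j : ℤ} {f : Finset (Fin n) → M} :
    f ∈ koszulBoundaries L p j ↔ ∃ g ∈ koszulChains L (p + 1) j, koszulD k n M g = f := by
  simp [koszulBoundaries, Submodule.mem_map]

theorem koszulBoundaries_le_koszulCycles [CharP k 2] {L : ℤ → Submodule k M}
    (hL : RespectsDegrees n L) (p : ℕ) (j : ℤ) :
    (koszulBoundaries L p j : Submodule k (Finset (Fin n) → M)) ≤ koszulCycles L p j := by
  intro f hf
  obtain ⟨g, hg, rfl⟩ := mem_koszulBoundaries.1 hf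
  exact mem_koszulCycles.2 ⟨koszulD_mem_koszulChains hL hg, koszulD_koszulD g⟩

end Koszul

/-! ### Acyclicity of the Koszul complex of a graded free module. -/

section Exactness

variable {k : Type*} [Field k] {n : ℕ}

theorem isFormOfDegree_divMonomial {p : MvPolynomial (Fin n) k} {e : ℤ} (hp : IsFormOfDegree p e)
    (t : Fin n) : IsFormOfDegree (p.divMonomial (Finsupp.single t 1)) (e - 1) := by
  rw [isFormOfDegree_iff] at *
  intro u hu
  rw [coeff_divMonomial]
  refine hp _ fun h => hu ?_
  rw [map_add, Finsupp.degree_single, Nat.cast_add, Nat.cast_one] at h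
  omega

theorem X_mul_divMonomial_of_ne {s t : Fin n} (hst : s ≠ t) (p : MvPolynomial (Fin n) k) :
    (X s * p).divMonomial (Finsupp.single t 1) = X s * p.divMonomial (Finsupp.single t 1) := by
  ext u
  rw [coeff_divMonomial, coeff_X_mul', coeff_X_mul', coeff_divMonomial]
  have h0 : (Finsupp.single t 1 + u : Fin n →₀ ℕ) s = u s := by
    rw [Finsupp.add_apply, Finsupp.single_eq_of_ne hst, zero_add]
  have h : s ∈ (Finsupp.single t 1 + u : Fin n →₀ ℕ).support ↔ s ∈ u.support := by
    rw [Finsupp.mem_support_iff, Finsupp.mem_support_iff, h0]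
  by_cases hs : s ∈ u.support
  · rw [if_pos hs, if_pos (h.2 hs), add_tsub_assoc_of_le]
    exact Finsupp.single_le_iff.2 (Nat.one_le_iff_ne_zero.2 (Finsupp.mem_support_iff.1 hs))
  · rw [if_neg hs, if_neg (h.not.2 hs)]

theorem divMonomial_sum {ι : Type*} (s : Finset ι) (f : ι → MvPolynomial (Fin n) k)
    (u : Fin n →₀ ℕ) : (∑ i ∈ s, f i).divMonomial u = ∑ i ∈ s, (f i).divMonomial u := by
  ext v
  simp [coeff_divMonomial, coeff_sum]

/-- The homotopy contracting the Koszul complex in the direction of one variable. -/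
noncomputable def koszulHomotopy (t : Fin n) (f : Finset (Fin n) → MvPolynomial (Fin n) k) :
    Finset (Fin n) → MvPolynomial (Fin n) k :=
  fun S => if t ∈ S then (f (S.erase t)).divMonomial (Finsupp.single t 1) else 0

theorem koszulHomotopy_mem_koszulChains (t : Fin n) {f : Finset (Fin n) → MvPolynomial (Fin n) k}
    {p : ℕ} {j c : ℤ} (hf : f ∈ koszulChains (fun e => formsOfDegree k n (e - c)) p j) :
    koszulHomotopy t f ∈ koszulChains (fun e => formsOfDegree k n (e - c)) (p + 1) j := by
  rw [mem_koszulChains] at *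
  refine fun S => ⟨fun hS => ?_, fun hS => ?_⟩
  · unfold koszulHomotopy
    split_ifs with ht
    · have h := isFormOfDegree_divMonomial ((hf (S.erase t)).1 (by
        rw [Finset.card_erase_of_mem ht, hS, Nat.add_sub_cancel])) t
      rw [mem_formsOfDegree]
      convert h using 1
      push_cast
      ring
    · exact Submodule.zero_mem _
  · unfold koszulHomotopy
    split_ifs with ht
    · rw [(hf (S.erase t)).2, zero_divMonomial]
      rw [Finset.card_erase_of_mem ht]
      have := Finset.card_pos.2 ⟨t, ht⟩
      omega
    · rfl

/-- Dividing by x_t inverts multiplication by x_t up to a remainder, so the homotopy moves a cycle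
to a homologous one free of x_t and of the exterior generator t. For t ∈ S the claim is the cycle
equation at S \ {t} divided by x_t. -/
theorem sub_koszulD_koszulHomotopy [CharP k 2] (t : Fin n)
    {f : Finset (Fin n) → MvPolynomial (Fin n) k} (hf : koszulD k n _ f = 0)
    (S : Finset (Fin n)) :
    f S - koszulD k n _ (koszulHomotopy t f) S =
      if t ∈ S then 0 else (f S).modMonomial (Finsupp.single t 1) := by
  rw [koszulD_apply]
  split_ifs with ht
  · have h := congrArg (fun p => p.divMonomial (Finsupp.single t 1)) (congrFun hf (S.erase t))
    simp only [koszulD_apply, Pi.zero_apply, zero_divMonomial, divMonomial_sum] at h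
    rw [Finset.compl_erase, Finset.sum_insert (by simpa using ht), Finset.insert_erase ht,
      smul_eq_mul, X_mul_divMonomial] at h
    rw [CharTwo.sub_eq_add]
    refine Eq.trans ?_ h
    congr 1
    refine Finset.sum_congr rfl fun s hs => ?_
    have hst : s ≠ t := fun h => (Finset.mem_compl.1 hs) (h ▸ ht)
    rw [koszulHomotopy, if_pos (Finset.mem_insert_of_mem ht), smul_eq_mul, smul_eq_mul,
      X_mul_divMonomial_of_ne hst, Finset.erase_insert_of_ne hst]
  · rw [Finset.sum_eq_single_of_mem t (by simpa using ht)]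
    · rw [koszulHomotopy, if_pos (Finset.mem_insert_self _ _), Finset.erase_insert ht, smul_eq_mul]
      rw [sub_eq_iff_eq_add]
      exact (modMonomial_add_divMonomial_single _ _).symm
    · intro s _ hst
      rw [koszulHomotopy, if_neg, smul_zero]
      rw [Finset.mem_insert, not_or]
      exact ⟨fun h => hst h.symm, ht⟩

theorem respectsDegrees_forms (c : ℤ) :
    RespectsDegrees n (fun e => formsOfDegree k n (e - c)) := by
  intro e s m hm
  have := IsFormOfDegree.X_mul hm s
  rw [mem_formsOfDegree, smul_eq_mul]
  convert this using 1
  ring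

theorem constantCoeff_koszulD (f : Finset (Fin n) → MvPolynomial (Fin n) k)
    (S : Finset (Fin n)) : constantCoeff (koszulD k n _ f S) = 0 := by
  simp [koszulD_apply, map_sum]

/-- The homotopies are applied one variable at a time. Taking remainders modulo x_t preserves what
was achieved for earlier variables. Once all variables are used, only a constant at ∅ can survive.
-/
theorem exists_koszul_homologous [CharP k 2] {p : ℕ} {j c : ℤ}
    {f : Finset (Fin n) → MvPolynomial (Fin n) k}
    (hf : f ∈ koszulCycles (fun e => formsOfDegree k n (e - c)) p j) (V : Finset (Fin n)) :
    ∃ g ∈ koszulChains (fun e => formsOfDegree k n (e - c)) (p + 1) j,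
      (∀ S, ∀ t ∈ V, t ∈ S → f S - koszulD k n _ g S = 0) ∧
      ∀ S, ∀ t ∈ V, ∀ u : Fin n →₀ ℕ, u t ≠ 0 → coeff u (f S - koszulD k n _ g S) = 0 := by
  induction V using Finset.induction_on with
  | empty => exact ⟨0, Submodule.zero_mem _, by simp, by simp⟩
  | insert t V _ ih =>
    obtain ⟨g, hg, h1, h2⟩ := ih
    have hz : f - koszulD k n _ g ∈ koszulCycles (fun e => formsOfDegree k n (e - c)) p j :=
      Submodule.sub_mem _ hf (koszulBoundaries_le_koszulCycles (respectsDegrees_forms c) p j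
        (mem_koszulBoundaries.2 ⟨g, hg, rfl⟩))
    rw [mem_koszulCycles] at hz
    have key := sub_koszulD_koszulHomotopy t hz.2
    refine ⟨g + koszulHomotopy t (f - koszulD k n _ g),
      Submodule.add_mem _ hg (koszulHomotopy_mem_koszulChains t hz.1), ?_, ?_⟩
    · intro S s hs hsS
      rw [map_add, Pi.add_apply, ← sub_sub, ← Pi.sub_apply, key S]
      split_ifs with htS
      · rfl
      · rcases Finset.mem_insert.1 hs with rfl | hs
        · exact absurd hsS htS
        · rw [Pi.sub_apply, h1 S s hs hsS]
          ext u
          by_cases hu : Finsupp.single t 1 ≤ u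
          · rw [coeff_modMonomial_of_le _ hu, coeff_zero]
          · rw [coeff_modMonomial_of_not_le _ hu]
    · intro S s hs u hu
      rw [map_add, Pi.add_apply, ← sub_sub, ← Pi.sub_apply, key S]
      split_ifs with htS
      · rfl
      · by_cases hle : Finsupp.single t 1 ≤ u
        · rw [coeff_modMonomial_of_le _ hle]
        · rw [coeff_modMonomial_of_not_le _ hle]
          rcases Finset.mem_insert.1 hs with rfl | hs
          · exact absurd (Finsupp.single_le_iff.2 (Nat.one_le_iff_ne_zero.2 hu)) hle
          · exact h2 S s hs u hu

/-- Exactness of the Koszul complex of the polynomial ring. -/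
theorem mem_koszulBoundaries_forms [CharP k 2] {p : ℕ} {j c : ℤ}
    {f : Finset (Fin n) → MvPolynomial (Fin n) k}
    (hf : f ∈ koszulCycles (fun e => formsOfDegree k n (e - c)) p j)
    (hf0 : constantCoeff (f ∅) = 0) :
    f ∈ koszulBoundaries (fun e => formsOfDegree k n (e - c)) p j := by
  obtain ⟨g, hg, h1, h2⟩ := exists_koszul_homologous hf Finset.univ
  refine mem_koszulBoundaries.2 ⟨g, hg, ?_⟩
  ext1 S
  rw [eq_comm, ← sub_eq_zero]
  rcases S.eq_empty_or_nonempty with rfl | ⟨t, ht⟩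
  · ext u
    by_cases hu : u = 0
    · subst hu
      rw [coeff_zero, coeff_sub]
      change constantCoeff (f ∅) - constantCoeff (koszulD k n _ g ∅) = 0
      rw [hf0, constantCoeff_koszulD, sub_zero]
    · obtain ⟨t, ht⟩ := Finsupp.ne_iff.1 hu
      exact h2 ∅ t (Finset.mem_univ t) u ht
  · exact h1 S t (Finset.mem_univ t) ht

theorem respectsDegrees_freeGraded {r : ℕ} (deg : Fin r → ℤ) :
    RespectsDegrees n (freeGraded (k := k) (n := n) deg) := by
  intro e s m hm
  rw [mem_freeGraded] at *
  exact fun a => respectsDegrees_forms (deg a) e s (m a) (hm a)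

/-- Exactness of the Koszul complex of a graded free module. -/
theorem mem_koszulBoundaries_freeGraded [CharP k 2] {r : ℕ} {deg : Fin r → ℤ} {p : ℕ} {j : ℤ}
    {f : Finset (Fin n) → Fin r → MvPolynomial (Fin n) k}
    (hf : f ∈ koszulCycles (freeGraded deg) p j) (hf0 : ∀ a, constantCoeff (f ∅ a) = 0) :
    f ∈ koszulBoundaries (freeGraded deg) p j := by
  rw [mem_koszulCycles] at hf
  have h : ∀ a, ∃ g ∈ koszulChains (fun e => formsOfDegree k n (e - deg a)) (p + 1) j,
      koszulD k n _ g = fun S => f S a := fun a => by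
    refine mem_koszulBoundaries.1 (mem_koszulBoundaries_forms (mem_koszulCycles.2 ⟨?_, ?_⟩)
      (hf0 a))
    · rw [mem_koszulChains]
      refine fun S => ⟨fun hS => mem_freeGraded.1 ((mem_koszulChains.1 hf.1 S).1 hS) a,
        fun hS => ?_⟩
      rw [apply_eq_zero_of_mem_koszulChains hf.1 hS, Pi.zero_apply]
    · have := koszulD_comp (k := k)
        (LinearMap.proj a : (Fin r → MvPolynomial (Fin n) k) →ₗ[MvPolynomial (Fin n) k] _) f
      rw [hf.2] at this
      exact this
  choose g hg hgf using h
  refine mem_koszulBoundaries.2 ⟨fun S a => g a S, ?_, ?_⟩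
  · rw [mem_koszulChains]
    refine fun S => ⟨fun hS => mem_freeGraded.2 fun a => (mem_koszulChains.1 (hg a) S).1 hS,
      fun hS => ?_⟩
    ext1 a
    exact apply_eq_zero_of_mem_koszulChains (hg a) hS
  · ext1 S
    ext1 a
    rw [← congrFun (hgf a) S]
    simp [koszulD_apply, Finset.sum_apply]

end Exactness

/-- The conditions say that f induces P/K ≅ Z/B. Two homology groups are later compared by
presenting both as the same P/K, which avoids constructing a connecting map. -/
theorem Submodule.finrank_quotient_submoduleOf_eq {k V W : Type*} [Field k] [AddCommGroup V]
    [Module k V] [AddCommGroup W] [Module k W] {Z B : Submodule k V} {P K : Submodule k W}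
    (f : W →ₗ[k] V) (hf : ∀ w ∈ P, f w ∈ Z) (hs : ∀ z ∈ Z, ∃ w ∈ P, f w - z ∈ B)
    (hk : ∀ w ∈ P, f w ∈ B ↔ w ∈ K) :
    Module.finrank k (Z ⧸ B.submoduleOf Z) = Module.finrank k (P ⧸ K.submoduleOf P) := by
  let g : P →ₗ[k] Z ⧸ B.submoduleOf Z := (B.submoduleOf Z).mkQ.comp (f.restrict hf)
  have hg : Function.Surjective g := by
    intro q
    obtain ⟨z, rfl⟩ := (B.submoduleOf Z).mkQ_surjective q
    obtain ⟨w, hw, hwz⟩ := hs z z.2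
    refine ⟨⟨w, hw⟩, ?_⟩
    rw [LinearMap.comp_apply, Submodule.mkQ_apply, Submodule.mkQ_apply, Submodule.Quotient.eq]
    exact hwz
  have hker : LinearMap.ker g = K.submoduleOf P := by
    ext w
    rw [LinearMap.mem_ker, LinearMap.comp_apply, Submodule.mkQ_apply,
      Submodule.Quotient.mk_eq_zero]
    exact hk w w.2
  rw [← hker]
  exact (g.quotKerEquivOfSurjective hg).finrank_eq.symm

/-! ### Dimension shifting in Koszul homology. -/

section Connecting

variable {k : Type*} [Field k] {n : ℕ}
variable {G M : Type*} [AddCommGroup M] [Module (MvPolynomial (Fin n) k) M] [Module k M]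
  [IsScalarTower k (MvPolynomial (Fin n) k) M] [AddCommGroup G] [Module (MvPolynomial (Fin n) k) G]
  [Module k G] [IsScalarTower k (MvPolynomial (Fin n) k) G]

/-- The image of a family of subspaces under a linear map. -/
noncomputable def gradedMap (φ : G →ₗ[MvPolynomial (Fin n) k] M) (L : ℤ → Submodule k G) (e : ℤ) :
    Submodule k M := (L e).map (φ.restrictScalars k)

/-- The intersection of a family of subspaces with the kernel of a linear map. -/
noncomputable def gradedKer (φ : G →ₗ[MvPolynomial (Fin n) k] M) (L : ℤ → Submodule k G) (e : ℤ) :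
    Submodule k G := L e ⊓ LinearMap.ker (φ.restrictScalars k)

/-- Applying a linear map to each coefficient of a Koszul chain. -/
noncomputable def koszulMap (φ : G →ₗ[MvPolynomial (Fin n) k] M) :
    (Finset (Fin n) → G) →ₗ[k] (Finset (Fin n) → M) :=
  LinearMap.pi fun S => (φ.restrictScalars k).comp (LinearMap.proj S)

theorem koszulMap_apply (φ : G →ₗ[MvPolynomial (Fin n) k] M) (f : Finset (Fin n) → G)
    (S : Finset (Fin n)) : koszulMap φ f S = φ (f S) := rfl

theorem koszulD_koszulMap (φ : G →ₗ[MvPolynomial (Fin n) k] M) (f : Finset (Fin n) → G) :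
    koszulD k n M (koszulMap φ f) = koszulMap φ (koszulD k n G f) :=
  koszulD_comp φ f

theorem RespectsDegrees.gradedMap {L : ℤ → Submodule k G} (hL : RespectsDegrees n L)
    (φ : G →ₗ[MvPolynomial (Fin n) k] M) : RespectsDegrees n (gradedMap φ L) := by
  rintro e s _ ⟨g, hg, rfl⟩
  exact ⟨X s • g, hL e s g hg, map_smul φ _ _⟩

theorem RespectsDegrees.gradedKer {L : ℤ → Submodule k G} (hL : RespectsDegrees n L)
    (φ : G →ₗ[MvPolynomial (Fin n) k] M) : RespectsDegrees n (gradedKer φ L) := by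
  rintro e s g ⟨hg, hg'⟩
  refine ⟨hL e s g hg, ?_⟩
  rw [SetLike.mem_coe, LinearMap.mem_ker, LinearMap.restrictScalars_apply] at hg' ⊢
  rw [map_smul, hg', smul_zero]

theorem koszulMap_mem_koszulChains (φ : G →ₗ[MvPolynomial (Fin n) k] M) {L : ℤ → Submodule k G}
    {p : ℕ} {j : ℤ} {f : Finset (Fin n) → G} (hf : f ∈ koszulChains L p j) :
    koszulMap φ f ∈ koszulChains (gradedMap φ L) p j := by
  rw [mem_koszulChains] at *
  refine fun S => ⟨fun hS => ⟨f S, (hf S).1 hS, rfl⟩, fun hS => ?_⟩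
  rw [koszulMap_apply, (hf S).2 hS, map_zero]

theorem exists_koszulMap_eq (φ : G →ₗ[MvPolynomial (Fin n) k] M) {L : ℤ → Submodule k G}
    {p : ℕ} {j : ℤ} {f : Finset (Fin n) → M} (hf : f ∈ koszulChains (gradedMap φ L) p j) :
    ∃ g ∈ koszulChains L p j, koszulMap φ g = f := by
  rw [mem_koszulChains] at hf
  have h : ∀ S : Finset (Fin n), ∃ g : G, ((S.card = p → g ∈ L (j - p)) ∧
      (S.card ≠ p → g = 0)) ∧ φ g = f S := by
    intro S
    by_cases hS : S.card = p
    · obtain ⟨g, hg, hgf⟩ := (hf S).1 hS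
      exact ⟨g, ⟨fun _ => hg, fun h => absurd hS h⟩, hgf⟩
    · exact ⟨0, ⟨fun h => absurd h hS, fun _ => rfl⟩, by rw [map_zero, (hf S).2 hS]⟩
  choose g hg hgf using h
  exact ⟨g, mem_koszulChains.2 hg, funext hgf⟩

theorem mem_koszulChains_gradedKer {φ : G →ₗ[MvPolynomial (Fin n) k] M} {L : ℤ → Submodule k G}
    {p : ℕ} {j : ℤ} {f : Finset (Fin n) → G} :
    f ∈ koszulChains (gradedKer φ L) p j ↔ f ∈ koszulChains L p j ∧ koszulMap φ f = 0 := by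
  constructor
  · intro hf
    refine ⟨koszulChains_mono (fun e => inf_le_left) p j hf, ?_⟩
    ext1 S
    rw [koszulMap_apply, Pi.zero_apply]
    by_cases hS : S.card = p
    · exact ((mem_koszulChains.1 hf S).1 hS).2
    · rw [apply_eq_zero_of_mem_koszulChains hf hS, map_zero]
  · rintro ⟨hf, h⟩
    exact mem_koszulChains.2 fun S => ⟨fun hS =>
      ⟨(mem_koszulChains.1 hf S).1 hS, congrFun h S⟩, (mem_koszulChains.1 hf S).2⟩

/-- The connecting isomorphism in Koszul homology, for the kernel of a map whose source has
no relevant Koszul homology. -/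
theorem koszulRank_succ_gradedMap [CharP k 2] (φ : G →ₗ[MvPolynomial (Fin n) k] M)
    {L : ℤ → Submodule k G} (hL : RespectsDegrees n L) (p : ℕ) (j : ℤ)
    (h0 : (koszulCycles (gradedKer φ L) p j : Submodule k (Finset (Fin n) → G)) ≤
      koszulBoundaries L p j)
    (h1 : (koszulCycles L (p + 1) j : Submodule k (Finset (Fin n) → G)) ≤
      koszulBoundaries L (p + 1) j) :
    koszulRank n (gradedMap φ L) (p + 1) j = koszulRank n (gradedKer φ L) p j := by
  -- P consists of the chains of G that become cycles under φ. Applying φ sends P onto the cycles of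
  -- the image, applying d sends it onto the cycles of the kernel, and both send exactly K to
  -- boundaries.
  let P : Submodule k (Finset (Fin n) → G) := koszulChains L (p + 1) j ⊓
    LinearMap.ker ((koszulMap φ).comp ((koszulD k n G).restrictScalars k))
  let K : Submodule k (Finset (Fin n) → G) :=
    (koszulBoundaries (gradedMap φ L) (p + 1) j).comap (koszulMap φ)
  have hP : ∀ f, f ∈ P ↔ f ∈ koszulChains L (p + 1) j ∧ koszulMap φ (koszulD k n G f) = 0 := by
    intro f
    simp [P]
  unfold koszulRank
  refine (Submodule.finrank_quotient_submoduleOf_eq (P := P) (K := K) (koszulMap φ) ?_ ?_ ?_).trans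
    (Submodule.finrank_quotient_submoduleOf_eq (P := P) (K := K)
      ((koszulD k n G).restrictScalars k) ?_ ?_ ?_).symm
  · intro f hf
    rw [hP] at hf
    exact mem_koszulCycles.2 ⟨koszulMap_mem_koszulChains φ hf.1, by
      rw [koszulD_koszulMap, hf.2]⟩
  · intro z hz
    rw [mem_koszulCycles] at hz
    obtain ⟨f, hf, rfl⟩ := exists_koszulMap_eq φ hz.1
    refine ⟨f, (hP f).2 ⟨hf, by rw [← koszulD_koszulMap, hz.2]⟩, ?_⟩
    rw [sub_self]
    exact Submodule.zero_mem _
  · intro f _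
    rfl
  · intro f hf
    rw [hP] at hf
    exact mem_koszulCycles.2 ⟨mem_koszulChains_gradedKer.2
      ⟨koszulD_mem_koszulChains hL hf.1, hf.2⟩, koszulD_koszulD f⟩
  · intro z hz
    obtain ⟨f, hf, hfz⟩ := mem_koszulBoundaries.1 (h0 hz)
    refine ⟨f, (hP f).2 ⟨hf, ?_⟩, ?_⟩
    · rw [hfz]
      exact (mem_koszulChains_gradedKer.1 (mem_koszulCycles.1 hz).1).2
    · rw [LinearMap.restrictScalars_apply, hfz, sub_self]
      exact Submodule.zero_mem _
  · intro f hf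
    rw [hP] at hf
    rw [Submodule.mem_comap, mem_koszulBoundaries, mem_koszulBoundaries,
      LinearMap.restrictScalars_apply]
    constructor
    · rintro ⟨g, hg, hgf⟩
      rw [mem_koszulChains_gradedKer] at hg
      obtain ⟨w, hw, hwf⟩ := mem_koszulBoundaries.1 (h1 (mem_koszulCycles.2
        ⟨Submodule.sub_mem _ hf.1 hg.1, by rw [map_sub, hgf, sub_self]⟩))
      refine ⟨koszulMap φ w, koszulMap_mem_koszulChains φ hw, ?_⟩
      rw [koszulD_koszulMap, hwf, map_sub, hg.2, sub_zero]
    · rintro ⟨w, hw, hwf⟩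
      obtain ⟨v, hv, rfl⟩ := exists_koszulMap_eq φ hw
      refine ⟨f - koszulD k n G v, mem_koszulChains_gradedKer.2
        ⟨Submodule.sub_mem _ hf.1 (koszulD_mem_koszulChains hL hv), ?_⟩, ?_⟩
      · rw [map_sub, ← koszulD_koszulMap, hwf, sub_self]
      · rw [map_sub, koszulD_koszulD, sub_zero]

end Connecting

/-! ### Graded Betti numbers as Koszul homology. -/

section Betti

variable {k : Type*} [Field k] {n : ℕ}

/-- The degree zero Koszul homology of a graded module is read off a minimal presentation. -/
theorem koszulRank_zero_gradedMap_freeGraded [CharP k 2] {M : Type*} [AddCommGroup M]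
    [Module (MvPolynomial (Fin n) k) M] [Module k M] [IsScalarTower k (MvPolynomial (Fin n) k) M]
    {r : ℕ} (deg : Fin r → ℤ)
    (φ : (Fin r → MvPolynomial (Fin n) k) →ₗ[MvPolynomial (Fin n) k] M)
    (hφ : ∀ g, φ g = 0 → ∀ a, constantCoeff (g a) = 0) (j : ℤ) :
    koszulRank n (gradedMap φ (freeGraded deg)) 0 j =
      (Finset.univ.filter fun a => deg a = j).card := by
  -- Koszul homology in degree zero is the module modulo the variables. For a minimal presentation
  -- it is read off the constant coefficients at the basis vectors of degree j; at the other basis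
  -- vectors they vanish for degree reasons.
  let ev : (Finset (Fin n) → Fin r → MvPolynomial (Fin n) k) →ₗ[k]
      ({a : Fin r // deg a = j} → k) :=
    LinearMap.pi fun a => (MvPolynomial.lcoeff k (0 : Fin n →₀ ℕ)).comp
      ((LinearMap.proj (R := k) (φ := fun _ : Fin r => MvPolynomial (Fin n) k) a.1).comp
        (LinearMap.proj (R := k) (φ := fun _ => Fin r → MvPolynomial (Fin n) k) ∅))
  have hev : ∀ f a, ev f a = constantCoeff (f ∅ a.1) := fun f a => rfl
  have hev0 : ∀ f ∈ koszulChains (freeGraded (k := k) (n := n) deg) 0 j,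
      ev f = 0 → ∀ a, constantCoeff (f ∅ a) = 0 := by
    intro f hf h a
    by_cases ha : deg a = j
    · exact congrFun h ⟨a, ha⟩
    · have h1 := mem_freeGraded.1 ((mem_koszulChains.1 hf ∅).1 rfl) a
      refine h1.constantCoeff_eq_zero fun h2 => ha ?_
      simp only [Nat.cast_zero] at h2
      omega
  have hD : ∀ (f : Finset (Fin n) → Fin r → MvPolynomial (Fin n) k) (S : Finset (Fin n))
      (a : Fin r), constantCoeff (koszulD k n _ f S a) = 0 := by
    intro f S a
    simp [koszulD_apply, Finset.sum_apply, map_sum]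
  unfold koszulRank
  rw [Submodule.finrank_quotient_submoduleOf_eq (P := koszulChains (freeGraded deg) 0 j)
    (K := LinearMap.ker ev) (koszulMap φ)]
  · have hsurj : Function.Surjective (ev.comp
        (koszulChains (freeGraded (k := k) (n := n) deg) 0 j).subtype) := by
      intro v
      classical
      refine ⟨⟨Pi.single ∅ fun a => if h : deg a = j then C (v ⟨a, h⟩) else 0, ?_⟩, ?_⟩
      · refine mem_koszulChains.2 fun S => ⟨fun hS => ?_, fun hS => ?_⟩
        · rw [Finset.card_eq_zero] at hS
          subst hS
          rw [Pi.single_eq_same, mem_freeGraded]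
          intro a
          split_ifs with h
          · have h1 := (formsOfDegree k n 0).smul_mem (v ⟨a, h⟩)
              (mem_formsOfDegree.2 isFormOfDegree_one)
            rw [smul_eq_C_mul, mul_one] at h1
            have h3 : C (v ⟨a, h⟩) ∈ formsOfDegree k n (j - (0 : ℕ) - deg a) := by
              simpa [h] using h1
            exact h3
          · exact isFormOfDegree_zero _
        · exact Pi.single_eq_of_ne (fun h => hS (by simp [h])) _
      · ext a
        rw [LinearMap.comp_apply, hev, Submodule.subtype_apply]
        dsimp only
        rw [Pi.single_eq_same, dif_pos a.2, constantCoeff_C]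
    have hker : LinearMap.ker (ev.comp (koszulChains (freeGraded deg) 0 j).subtype) =
        (LinearMap.ker ev).submoduleOf (koszulChains (freeGraded deg) 0 j) := rfl
    rw [← hker, (LinearMap.quotKerEquivOfSurjective _ hsurj).finrank_eq,
      Module.finrank_fintype_fun_eq_card,
      Fintype.card_subtype]
  · intro f hf
    have := koszulMap_mem_koszulChains φ hf
    exact mem_koszulCycles.2 ⟨this, koszulD_eq_zero_of_mem_koszulChains_zero this⟩
  · intro z hz
    obtain ⟨f, hf, rfl⟩ := exists_koszulMap_eq φ (mem_koszulCycles.1 hz).1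
    exact ⟨f, hf, by rw [sub_self]; exact Submodule.zero_mem _⟩
  · intro f hf
    rw [mem_koszulBoundaries, LinearMap.mem_ker]
    constructor
    · rintro ⟨g, hg, hgf⟩
      obtain ⟨w, hw, rfl⟩ := exists_koszulMap_eq φ hg
      ext a
      have h := congrFun hgf ∅
      rw [koszulD_koszulMap, koszulMap_apply, koszulMap_apply, ← sub_eq_zero, ← map_sub] at h
      have h1 := hφ _ h a
      rw [Pi.sub_apply, map_sub, hD, zero_sub, neg_eq_zero] at h1
      exact h1
    · intro h
      obtain ⟨w, hw, rfl⟩ := mem_koszulBoundaries.1 (mem_koszulBoundaries_freeGraded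
        (mem_koszulCycles.2 ⟨hf, koszulD_eq_zero_of_mem_koszulChains_zero hf⟩) (hev0 f hf h))
      exact ⟨koszulMap φ w, koszulMap_mem_koszulChains φ hw, koszulD_koszulMap φ w⟩

/-- The homogeneous pieces of `R ⧸ I`. -/
noncomputable def quotientGraded (I : Ideal (MvPolynomial (Fin n) k)) (e : ℤ) :
    Submodule k (MvPolynomial (Fin n) k ⧸ I) :=
  (formsOfDegree k n e).map (Ideal.Quotient.mkₐ k I).toLinearMap

theorem mem_quotientGraded {I : Ideal (MvPolynomial (Fin n) k)} {e : ℤ}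
    {x : MvPolynomial (Fin n) k ⧸ I} :
    x ∈ quotientGraded I e ↔ ∃ p, IsFormOfDegree p e ∧ Ideal.Quotient.mk I p = x := by
  simp [quotientGraded, Submodule.mem_map, mem_formsOfDegree]

namespace MinimalGradedFreeResolution

variable {I : Ideal (MvPolynomial (Fin n) k)}

theorem gradedMap_ε (hI : I.IsHomogeneous (homogeneousSubmodule (Fin n) k))
    (F : MinimalGradedFreeResolution I) :
    gradedMap F.ε (freeGraded (F.deg 0)) = quotientGraded I := by
  choose p hp hε using F.ε_graded
  -- ψ lifts ε to a graded map into the polynomial ring, where components can be taken.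
  let ψ : (Fin (F.rank 0) → MvPolynomial (Fin n) k) →ₗ[MvPolynomial (Fin n) k]
    MvPolynomial (Fin n) k := Fintype.linearCombination _ p
  have hψ : ∀ b, ψ (Pi.single b 1) = p b := fun b => by
    simp [ψ, Fintype.linearCombination_apply_single]
  have hψg : ∀ b, IsFormOfDegree (ψ (Pi.single b 1)) (F.deg 0 b - 0) := fun b => by
    rw [hψ, sub_zero]
    exact hp b
  have hεψ : ∀ g, F.ε g = Ideal.Quotient.mk I (ψ g) := by
    intro g
    rw [F.ε.apply_eq_sum_single, ψ.apply_eq_sum_single, map_sum]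
    refine Finset.sum_congr rfl fun b _ => ?_
    rw [hε, hψ, smul_eq_mul, map_mul]
    rfl
  ext j x
  rw [mem_quotientGraded]
  constructor
  · rintro ⟨g, hg, rfl⟩
    refine ⟨ψ g, ?_, (hεψ g).symm⟩
    have := formComponent_of_graded hψg j g
    rw [freeComponent_of_mem hg, sub_zero] at this
    rw [← this]
    exact isFormOfDegree_formComponent _ _
  · rintro ⟨q, hq, rfl⟩
    obtain ⟨g, hg⟩ := F.ε_surjective (Ideal.Quotient.mk I q)
    rw [hεψ, Ideal.Quotient.mk_eq_mk_iff_sub_mem] at hg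
    refine ⟨freeComponent (F.deg 0) j g, freeComponent_mem _ _ _, ?_⟩
    rw [LinearMap.restrictScalars_apply, hεψ, Ideal.Quotient.mk_eq_mk_iff_sub_mem,
      ← formComponent_of_graded hψg, sub_zero, ← hq.formComponent_eq,
      ← map_sub, ← hq.formComponent_eq]
    exact hI.formComponent_mem (by rwa [hq.formComponent_eq]) j

theorem constantCoeff_d (F : MinimalGradedFreeResolution I) (i : ℕ)
    (g : Fin (F.rank (i + 1)) → MvPolynomial (Fin n) k) (a : Fin (F.rank i)) :
    constantCoeff (F.d i g a) = 0 := by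
  rw [(F.d i).apply_eq_sum_single, Finset.sum_apply, map_sum]
  refine Finset.sum_eq_zero fun b _ => ?_
  rw [Pi.smul_apply, smul_eq_mul, map_mul, F.minimal, mul_zero]

theorem gradedKer_eq_gradedMap (F : MinimalGradedFreeResolution I) (i : ℕ) {M : Type*}
    [AddCommGroup M] [Module (MvPolynomial (Fin n) k) M] [Module k M]
    [IsScalarTower k (MvPolynomial (Fin n) k) M]
    (φ : (Fin (F.rank i) → MvPolynomial (Fin n) k) →ₗ[MvPolynomial (Fin n) k] M)
    (hφ : Function.Exact (F.d i) φ) :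
    gradedKer φ (freeGraded (F.deg i)) = gradedMap (F.d i) (freeGraded (F.deg (i + 1))) := by
  ext j g
  constructor
  · rintro ⟨hg, hg'⟩
    obtain ⟨h, rfl⟩ := (hφ g).1 hg'
    refine ⟨freeComponent (F.deg (i + 1)) j h, freeComponent_mem _ _ _, ?_⟩
    rw [LinearMap.restrictScalars_apply, ← freeComponent_of_graded (F.d_graded i),
      freeComponent_of_mem hg]
  · rintro ⟨h, hh, rfl⟩
    exact ⟨map_mem_freeGraded (F.d_graded i) hh, (hφ _).2 ⟨h, rfl⟩⟩

/-- Minimality enters here. For p = 0 the free module does have Koszul homology, given by constant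
coefficients, but elements in the image of the differential have none. -/
theorem koszulCycles_gradedMap_d_le [CharP k 2] (F : MinimalGradedFreeResolution I) (i p : ℕ)
    (j : ℤ) :
    (koszulCycles (gradedMap (F.d i) (freeGraded (F.deg (i + 1)))) p j :
      Submodule k (Finset (Fin n) → _)) ≤ koszulBoundaries (freeGraded (F.deg i)) p j := by
  intro f hf
  rw [mem_koszulCycles] at hf
  have hle : ∀ e, gradedMap (F.d i) (freeGraded (F.deg (i + 1))) e ≤
      freeGraded (k := k) (n := n) (F.deg i) e := by
    rintro e _ ⟨h, hh, rfl⟩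
    exact map_mem_freeGraded (F.d_graded i) hh
  refine mem_koszulBoundaries_freeGraded
    (mem_koszulCycles.2 ⟨koszulChains_mono hle p j hf.1, hf.2⟩) fun a => ?_
  obtain ⟨g, _, rfl⟩ := exists_koszulMap_eq _ hf.1
  rw [koszulMap_apply, constantCoeff_d]

theorem koszulRank_gradedMap [CharP k 2] (F : MinimalGradedFreeResolution I) (i : ℕ) {M : Type*}
    [AddCommGroup M] [Module (MvPolynomial (Fin n) k) M] [Module k M]
    [IsScalarTower k (MvPolynomial (Fin n) k) M]
    (φ : (Fin (F.rank i) → MvPolynomial (Fin n) k) →ₗ[MvPolynomial (Fin n) k] M)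
    (hφ : Function.Exact (F.d i) φ) (p : ℕ) (j : ℤ) :
    koszulRank n (gradedMap φ (freeGraded (F.deg i))) (p + 1) j =
      koszulRank n (gradedMap (F.d i) (freeGraded (F.deg (i + 1)))) p j := by
  rw [← F.gradedKer_eq_gradedMap i φ hφ]
  refine koszulRank_succ_gradedMap φ (respectsDegrees_freeGraded _) p j ?_ ?_
  · rw [F.gradedKer_eq_gradedMap i φ hφ]
    exact F.koszulCycles_gradedMap_d_le i p j
  · intro f hf
    refine mem_koszulBoundaries_freeGraded hf fun a => ?_
    rw [apply_eq_zero_of_mem_koszulChains (mem_koszulCycles.1 hf).1 (by simp), Pi.zero_apply,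
      map_zero]

/-- Each syzygy step lowers the homological degree by one; iteration reduces everything to degree
zero, where the basis elements can be counted. -/
theorem koszulRank_add (hI : I.IsHomogeneous (homogeneousSubmodule (Fin n) k)) [CharP k 2]
    (F : MinimalGradedFreeResolution I) (i p : ℕ) (j : ℤ) :
    koszulRank n (quotientGraded I) (p + (i + 1)) j =
      koszulRank n (gradedMap (F.d i) (freeGraded (F.deg (i + 1)))) p j := by
  induction i generalizing p with
  | zero =>
    rw [← F.gradedMap_ε hI]
    exact F.koszulRank_gradedMap 0 F.ε F.exact_zero p j
  | succ i ih =>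
    rw [show p + (i + 1 + 1) = (p + 1) + (i + 1) by ring, ih (p + 1)]
    exact F.koszulRank_gradedMap (i + 1) (F.d i) (F.exact_succ i) p j

/-- Graded Betti numbers are the dimensions of the Koszul homology of `R ⧸ I`. -/
theorem betti_eq_koszulRank (hI : I.IsHomogeneous (homogeneousSubmodule (Fin n) k)) [CharP k 2]
    (F : MinimalGradedFreeResolution I) (i : ℕ) (j : ℤ) :
    F.betti i j = koszulRank n (quotientGraded I) i j := by
  unfold betti
  rcases i with _ | i
  · rw [← F.gradedMap_ε hI, koszulRank_zero_gradedMap_freeGraded]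
    intro g hg a
    obtain ⟨h, rfl⟩ := (F.exact_zero g).1 hg
    exact F.constantCoeff_d 0 h a
  · rw [← zero_add (i + 1), F.koszulRank_add hI i 0 j, koszulRank_zero_gradedMap_freeGraded,
      zero_add]
    intro g hg a
    obtain ⟨h, rfl⟩ := (F.exact_succ i g).1 hg
    exact F.constantCoeff_d (i + 1) h a

end MinimalGradedFreeResolution

end Betti

/-! ### Existence of minimal graded free resolutions. -/

section Existence

variable {k : Type*} [Field k] {n : ℕ}

/-- A graded submodule of a graded free module is generated by finitely many homogeneous
elements. -/
theorem exists_homogeneous_generators {r : ℕ} (deg : Fin r → ℤ)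
    (N : Submodule (MvPolynomial (Fin n) k) (Fin r → MvPolynomial (Fin n) k))
    (hN : ∀ g ∈ N, ∀ j, freeComponent deg j g ∈ N) :
    ∃ (r' : ℕ) (g : Fin r' → Fin r → MvPolynomial (Fin n) k) (deg' : Fin r' → ℤ),
      (∀ b, g b ∈ freeGraded deg (deg' b)) ∧
        Submodule.span (MvPolynomial (Fin n) k) (Set.range g) = N := by
  classical
  obtain ⟨S, hS⟩ : N.FG := IsNoetherian.noetherian N
  choose s hs using sum_freeComponent (k := k) (n := n) deg
  let T : Finset (Fin r → MvPolynomial (Fin n) k) :=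
    S.biUnion fun g => (s g).image fun j => freeComponent deg j g
  have hT : ∀ g ∈ T, g ∈ N ∧ ∃ j, g ∈ freeGraded deg j := by
    intro g hg
    simp only [T, Finset.mem_biUnion, Finset.mem_image] at hg
    obtain ⟨h, hh, j, _, rfl⟩ := hg
    exact ⟨hN h (hS ▸ Submodule.subset_span hh) j, j, freeComponent_mem _ _ _⟩
  have hd : ∀ b : Fin T.card, ∃ j, (T.equivFin.symm b).1 ∈ freeGraded deg j :=
    fun b => (hT _ (T.equivFin.symm b).2).2
  choose deg' hdeg' using hd
  refine ⟨T.card, fun b => (T.equivFin.symm b).1, deg', hdeg', ?_⟩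
  have hrange : (Set.range fun b => (T.equivFin.symm b).1) = (T : Set _) := by
    ext g
    constructor
    · rintro ⟨b, rfl⟩
      exact (T.equivFin.symm b).2
    · intro hg
      exact ⟨T.equivFin ⟨g, hg⟩, by simp⟩
  rw [hrange]
  apply le_antisymm
  · rw [Submodule.span_le]
    exact fun g hg => (hT g hg).1
  · rw [← hS, Submodule.span_le]
    intro g hg
    rw [← hs g]
    refine Submodule.sum_mem _ fun j hj => Submodule.subset_span ?_
    exact Finset.mem_coe.2 (Finset.mem_biUnion.2 ⟨g, hg, Finset.mem_image_of_mem _ hj⟩)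

/-- Take the least possible number of homogeneous generators. A relation with a nonzero constant
coefficient at b has a component of degree `deg' b` in which that coefficient is a unit, so
generator b would be redundant. -/
theorem exists_minimal_graded_cover {r : ℕ} (deg : Fin r → ℤ)
    (N : Submodule (MvPolynomial (Fin n) k) (Fin r → MvPolynomial (Fin n) k))
    (hN : ∀ g ∈ N, ∀ j, freeComponent deg j g ∈ N) :
    ∃ (r' : ℕ) (deg' : Fin r' → ℤ) (φ : (Fin r' → MvPolynomial (Fin n) k)
        →ₗ[MvPolynomial (Fin n) k] (Fin r → MvPolynomial (Fin n) k)),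
      (∀ b a, IsFormOfDegree (φ (Pi.single b 1) a) (deg' b - deg a)) ∧
      LinearMap.range φ = N ∧ ∀ h, φ h = 0 → ∀ b, constantCoeff (h b) = 0 := by
  classical
  have hex := exists_homogeneous_generators deg N hN
  obtain ⟨g, deg', hg, hspan⟩ := Nat.find_spec hex
  have hmin : ∀ r'' < Nat.find hex, _ := fun r'' h => Nat.find_min hex h
  generalize Nat.find hex = r' at g deg' hg hspan hmin
  let φ : (Fin r' → MvPolynomial (Fin n) k) →ₗ[MvPolynomial (Fin n) k]
    (Fin r → MvPolynomial (Fin n) k) := Fintype.linearCombination _ g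
  have hφs : ∀ b, φ (Pi.single b 1) = g b := fun b => by
    simp [φ, Fintype.linearCombination_apply_single]
  have hφ : ∀ b a, IsFormOfDegree (φ (Pi.single b 1) a) (deg' b - deg a) := fun b a => by
    rw [hφs]
    exact mem_freeGraded.1 (hg b) a
  refine ⟨r', deg', φ, hφ, ?_, ?_⟩
  · rw [← hspan]
    exact Fintype.range_linearCombination _ g
  · intro h hh b
    by_contra hne
    have hc := freeComponent_of_graded hφ (deg' b) h
    rw [hh, map_zero] at hc
    have hb : freeComponent deg' (deg' b) h b = C (constantCoeff (h b)) := by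
      rw [freeComponent_apply, sub_self, (isFormOfDegree_formComponent 0 (h b)).eq_C]
      congr 1
      exact (coeff_formComponent 0 (h b) 0).trans (by simp; rfl)
    rw [φ.apply_eq_sum_single] at hc
    simp only [hφs] at hc
    obtain _ | r'' := r'
    · exact b.elim0
    refine hmin r'' (Nat.lt_succ_self _) ⟨g ∘ b.succAbove, deg' ∘ b.succAbove,
      fun c => hg _, ?_⟩
    rw [← hspan]
    apply le_antisymm
    · exact Submodule.span_mono (Set.range_comp_subset_range _ _)
    · rw [Submodule.span_le]
      have hothers : ∀ c, g (b.succAbove c) ∈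
          Submodule.span (MvPolynomial (Fin n) k) (Set.range (g ∘ b.succAbove)) :=
        fun c => Submodule.subset_span ⟨c, rfl⟩
      rintro _ ⟨c, rfl⟩
      rcases Fin.eq_self_or_eq_succAbove b c with rfl | ⟨c, rfl⟩
      · rw [Fin.sum_univ_succAbove _ c, hb, eq_comm] at hc
        have h1 : (C (constantCoeff (h c)) : MvPolynomial (Fin n) k) • g c ∈
            Submodule.span (MvPolynomial (Fin n) k) (Set.range (g ∘ c.succAbove)) := by
          rw [eq_neg_of_add_eq_zero_left hc]
          exact Submodule.neg_mem _ (Submodule.sum_mem _ fun a _ =>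
            Submodule.smul_mem _ _ (hothers a))
        have h2 := Submodule.smul_mem _ (C (constantCoeff (h c))⁻¹) h1
        rwa [smul_smul, ← C_mul, inv_mul_cancel₀ hne, C_1, one_smul] at h2
      · exact hothers c

/-- A graded free module together with a graded submodule of relations without constant
coefficients. -/
structure GradedSyzygies (k : Type*) [Field k] (n : ℕ) where
  /-- the rank of the free module -/
  rank : ℕ
  /-- the degrees of the basis elements -/
  deg : Fin rank → ℤ
  /-- the submodule of relations -/
  syz : Submodule (MvPolynomial (Fin n) k) (Fin rank → MvPolynomial (Fin n) k)
  /-- the submodule of relations is graded -/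
  graded : ∀ g ∈ syz, ∀ j, freeComponent deg j g ∈ syz
  /-- the relations have no constant coefficients -/
  minimal : ∀ g ∈ syz, ∀ a, constantCoeff (g a) = 0

namespace GradedSyzygies

theorem exists_next (S : GradedSyzygies k n) :
    ∃ (T : GradedSyzygies k n) (φ : (Fin T.rank → MvPolynomial (Fin n) k)
        →ₗ[MvPolynomial (Fin n) k] (Fin S.rank → MvPolynomial (Fin n) k)),
      (∀ b a, IsFormOfDegree (φ (Pi.single b 1) a) (T.deg b - S.deg a)) ∧
      LinearMap.range φ = S.syz ∧ LinearMap.ker φ = T.syz := by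
  obtain ⟨r', deg', φ, hφ, hr, hm⟩ := exists_minimal_graded_cover S.deg S.syz S.graded
  refine ⟨⟨r', deg', LinearMap.ker φ, fun g hg j => ?_, fun g hg => hm g hg⟩, φ, hφ, hr, rfl⟩
  rw [LinearMap.mem_ker, ← freeComponent_of_graded hφ, LinearMap.mem_ker.1 hg, map_zero]

/-- The next step of a minimal resolution. -/
noncomputable def next (S : GradedSyzygies k n) : GradedSyzygies k n := S.exists_next.choose

/-- The differential to a step of a minimal resolution from the next one. -/
noncomputable def nextMap (S : GradedSyzygies k n) :
    (Fin S.next.rank → MvPolynomial (Fin n) k) →ₗ[MvPolynomial (Fin n) k]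
      (Fin S.rank → MvPolynomial (Fin n) k) :=
  S.exists_next.choose_spec.choose

theorem nextMap_spec (S : GradedSyzygies k n) :
    (∀ b a, IsFormOfDegree (S.nextMap (Pi.single b 1) a) (S.next.deg b - S.deg a)) ∧
      LinearMap.range S.nextMap = S.syz ∧ LinearMap.ker S.nextMap = S.next.syz :=
  S.exists_next.choose_spec.choose_spec

/-- The steps of a minimal resolution. -/
noncomputable def steps (S : GradedSyzygies k n) : ℕ → GradedSyzygies k n
  | 0 => S
  | i + 1 => (S.steps i).next

end GradedSyzygies

theorem constantCoeff_eq_zero_of_mem {I : Ideal (MvPolynomial (Fin n) k)}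
    (hI : I.IsHomogeneous (homogeneousSubmodule (Fin n) k)) (hI1 : I ≠ ⊤)
    {p : MvPolynomial (Fin n) k} (hp : p ∈ I) : constantCoeff p = 0 := by
  by_contra hne
  refine hI1 (Ideal.eq_top_of_isUnit_mem I (hI.formComponent_mem hp 0) ?_)
  rw [(isFormOfDegree_formComponent 0 p).eq_C]
  refine (isUnit_iff_ne_zero.2 ?_).map C
  rwa [show constantCoeff (formComponent 0 p) = constantCoeff p from
    (coeff_formComponent 0 p 0).trans (by simp; rfl)]

theorem nonempty_minimalGradedFreeResolution {I : Ideal (MvPolynomial (Fin n) k)}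
    (hI : I.IsHomogeneous (homogeneousSubmodule (Fin n) k)) (hI1 : I ≠ ⊤) :
    Nonempty (MinimalGradedFreeResolution I) := by
  let S : GradedSyzygies k n :=
    { rank := 1
      deg := fun _ => 0
      syz := Submodule.comap (LinearMap.proj (R := MvPolynomial (Fin n) k)
        (φ := fun _ : Fin 1 => MvPolynomial (Fin n) k) 0) I
      graded := fun g hg j => hI.formComponent_mem hg _
      minimal := fun g hg a => by
        rw [Subsingleton.elim a 0]
        exact constantCoeff_eq_zero_of_mem hI hI1 hg }
  have hmem : ∀ i g, (S.steps i).nextMap g ∈ (S.steps i).syz := fun i g => by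
    rw [← (S.steps i).nextMap_spec.2.1]
    exact ⟨g, rfl⟩
  refine ⟨
    { rank := fun i => (S.steps i).rank
      deg := fun i => (S.steps i).deg
      ε := I.mkQ.comp (LinearMap.proj (0 : Fin 1))
      d := fun i => (S.steps i).nextMap
      ε_graded := fun a => ⟨1, isFormOfDegree_one, ?_⟩
      d_graded := fun i => (S.steps i).nextMap_spec.1
      ε_surjective := fun x => ?_
      exact_zero := fun g => ?_
      exact_succ := fun i g => ?_
      minimal := fun i b a => (S.steps i).minimal _ (hmem i _) a }⟩
  · have h : ∀ b : Fin 1, I.mkQ ((Pi.single b 1 : Fin 1 → MvPolynomial (Fin n) k) 0) =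
        Ideal.Quotient.mk I 1 := fun b => by
      rw [show (0 : Fin 1) = b from Subsingleton.elim _ _, Pi.single_eq_same]
      rfl
    exact h a
  · obtain ⟨p, rfl⟩ := I.mkQ_surjective x
    exact ⟨fun _ => p, rfl⟩
  · have h : g ∈ S.syz ↔ g ∈ LinearMap.range (S.steps 0).nextMap := by
      rw [(S.steps 0).nextMap_spec.2.1]
      rfl
    exact (Submodule.Quotient.mk_eq_zero I).trans h
  · have h : g ∈ LinearMap.ker (S.steps i).nextMap ↔
        g ∈ LinearMap.range (S.steps (i + 1)).nextMap := by
      rw [(S.steps (i + 1)).nextMap_spec.2.1, (S.steps i).nextMap_spec.2.2]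
      rfl
    exact h

end Existence

/-! ### Ranks of bilinear forms. -/

section BilinearForms

variable {k X Y : Type*} [Field k] [AddCommGroup X] [Module k X] [AddCommGroup Y] [Module k Y]

theorem LinearMap.finrank_range_flip [FiniteDimensional k Y] (B : X →ₗ[k] Y →ₗ[k] k) :
    Module.finrank k (LinearMap.range B.flip) = Module.finrank k (LinearMap.range B) := by
  have h : B.flip = B.dualMap.comp (Module.evalEquiv k Y).toLinearMap := by
    ext y x
    rfl
  rw [h, LinearMap.range_comp, LinearEquiv.range, Submodule.map_top,
    LinearMap.finrank_range_dualMap_eq_finrank_range]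

/-- An alternating form has even rank. -/
theorem LinearMap.IsAlt.even_finrank_range [FiniteDimensional k X]
    {B : X →ₗ[k] X →ₗ[k] k} (hB : B.IsAlt) :
    Even (Module.finrank k (LinearMap.range B)) := by
  suffices h : ∀ (d : ℕ) (V : Type _) [AddCommGroup V] [Module k V] [FiniteDimensional k V]
      (C : V →ₗ[k] V →ₗ[k] k), C.IsAlt → Module.finrank k V = d →
      ∃ c, Module.finrank k V = Module.finrank k (LinearMap.ker C) + 2 * c by
    obtain ⟨c, hc⟩ := h _ X B hB rfl
    have := LinearMap.finrank_range_add_finrank_ker B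
    exact ⟨c, by omega⟩
  intro d
  induction d using Nat.strong_induction_on with
  | _ d ih =>
  intro V _ _ _ C hC hd
  by_cases h0 : C = 0
  · refine ⟨0, ?_⟩
    rw [h0, LinearMap.ker_zero, finrank_top, mul_zero, add_zero]
  obtain ⟨x, hx⟩ : ∃ x, C x ≠ 0 := by
    by_contra! h
    exact h0 (LinearMap.ext h)
  obtain ⟨y', hy'⟩ : ∃ y, C x y ≠ 0 := by
    by_contra! h
    exact hx (LinearMap.ext h)
  obtain ⟨y, hxy⟩ : ∃ y, C x y = 1 := ⟨(C x y')⁻¹ • y', by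
    rw [map_smul, smul_eq_mul, inv_mul_cancel₀ hy']⟩
  have hyx : C y x = -1 := by rw [← hC.neg x y, hxy]
  -- W is the orthogonal complement of the hyperbolic plane spanned by x and y. It has codimension
  -- two and the restricted form has the same radical, so induction applies.
  let W : Submodule k V := LinearMap.ker ((C x).prod (C y))
  have hW : ∀ z, z ∈ W ↔ C x z = 0 ∧ C y z = 0 := fun z => by
    simp [W, LinearMap.mem_ker]
  have hsurj : LinearMap.range ((C x).prod (C y)) = ⊤ := by
    rw [LinearMap.range_eq_top]
    rintro ⟨a, b⟩
    refine ⟨a • y - b • x, ?_⟩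
    simp [hxy, hyx, hC x, hC y]
  have hfin := LinearMap.finrank_range_add_finrank_ker ((C x).prod (C y))
  rw [hsurj, finrank_top, Module.finrank_prod, Module.finrank_self] at hfin
  change 1 + 1 + Module.finrank k W = _ at hfin
  obtain ⟨c, hc⟩ := ih (Module.finrank k W) (by omega) W (C.domRestrict₁₂ W W)
    (fun w => hC w) rfl
  have hker : (LinearMap.ker (C.domRestrict₁₂ W W)).map W.subtype = LinearMap.ker C := by
    ext z
    constructor
    · rintro ⟨w, hw, rfl⟩
      rw [SetLike.mem_coe, LinearMap.mem_ker] at hw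
      rw [LinearMap.mem_ker]
      ext v
      have hw1 := (hW w).1 w.2
      -- This is the projection of v to W along the hyperbolic plane.
      have hmem : v - (C x v) • y + (C y v) • x ∈ W := by
        rw [hW]
        simp [hxy, hyx, hC x, hC y]
      have h2 : C w (v - (C x v) • y + (C y v) • x) = 0 :=
        LinearMap.congr_fun hw ⟨_, hmem⟩
      have h3 : C w y = 0 := by rw [← hC.neg y w, hw1.2, neg_zero]
      have h4 : C w x = 0 := by rw [← hC.neg x w, hw1.1, neg_zero]
      simpa [h3, h4] using h2
    · intro hz
      rw [LinearMap.mem_ker] at hz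
      have hzW : z ∈ W := by
        rw [hW, ← hC.neg z x, ← hC.neg z y, hz]
        simp
      refine ⟨⟨z, hzW⟩, ?_, rfl⟩
      rw [SetLike.mem_coe, LinearMap.mem_ker]
      ext v
      change C z v = 0
      rw [hz, LinearMap.zero_apply]
  rw [← hker, Submodule.finrank_map_subtype_eq]
  exact ⟨c + 1, by omega⟩

end BilinearForms

/-! ### Dimension counts in the Koszul complex. -/

section KoszulNumerics

variable {k : Type*} [Field k] {n : ℕ}
variable {M : Type*} [AddCommGroup M] [Module k M]

/-- The rank of the Koszul differential on chains of a given bidegree. -/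
noncomputable def koszulDRank (n : ℕ) {M : Type*} [AddCommGroup M]
    [Module (MvPolynomial (Fin n) k) M] [Module k M]
    [IsScalarTower k (MvPolynomial (Fin n) k) M] (L : ℤ → Submodule k M) (p : ℕ) (j : ℤ) : ℕ :=
  Module.finrank k ((koszulChains L p j).map ((koszulD k n M).restrictScalars k))

/-- Koszul chains as functions on the subsets of a given size. -/
def koszulChainsEquiv (L : ℤ → Submodule k M) (p : ℕ) (j : ℤ) :
    (koszulChains L p j : Submodule k (Finset (Fin n) → M)) ≃ₗ[k]
      ({S : Finset (Fin n) // S.card = p} → L (j - p)) where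
  toFun f S := ⟨f.1 S, (mem_koszulChains.1 f.2 S).1 S.2⟩
  map_add' f g := rfl
  map_smul' c f := rfl
  invFun g := ⟨fun S => if h : S.card = p then g ⟨S, h⟩ else 0, mem_koszulChains.2 fun S =>
    ⟨fun h => by simp only [dif_pos h, SetLike.coe_mem], fun h => dif_neg h⟩⟩
  left_inv f := by
    ext S
    by_cases h : S.card = p
    · simp only [dif_pos h]
    · simp only [dif_neg h, apply_eq_zero_of_mem_koszulChains f.2 h]
  right_inv g := by
    ext S
    simp only [dif_pos S.2]

theorem finrank_koszulChains [FiniteDimensional k M] (L : ℤ → Submodule k M) (p : ℕ) (j : ℤ) :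
    Module.finrank k (koszulChains L p j : Submodule k (Finset (Fin n) → M)) =
      n.choose p * Module.finrank k (L (j - p)) := by
  rw [(koszulChainsEquiv L p j).finrank_eq, Module.finrank_pi_fintype, Finset.sum_const,
    Finset.card_univ, Fintype.card_finset_len, Fintype.card_fin, smul_eq_mul]

theorem finrank_map_add_finrank_inf_ker {V W : Type*} [AddCommGroup V] [Module k V]
    [FiniteDimensional k V] [AddCommGroup W] [Module k W] (P : Submodule k V) (f : V →ₗ[k] W) :
    Module.finrank k (P.map f) + Module.finrank k (P ⊓ LinearMap.ker f : Submodule k V) =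
      Module.finrank k P := by
  rw [← LinearMap.finrank_range_add_finrank_ker (f.domRestrict P), LinearMap.range_domRestrict,
    LinearMap.ker_domRestrict, ← Submodule.finrank_map_subtype_eq, Submodule.map_comap_subtype]

variable [Module (MvPolynomial (Fin n) k) M] [IsScalarTower k (MvPolynomial (Fin n) k) M]

/-- Rank-nullity: chains split into homology, the rank of the outgoing differential, and the rank of
the incoming one. -/
theorem koszulRank_add_koszulDRank [CharP k 2] [FiniteDimensional k M] {L : ℤ → Submodule k M}
    (hL : RespectsDegrees n L) (p : ℕ) (j : ℤ) :
    koszulRank n L p j + koszulDRank n L p j + koszulDRank n L (p + 1) j =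
      n.choose p * Module.finrank k (L (j - p)) := by
  rw [← finrank_koszulChains, ← finrank_map_add_finrank_inf_ker (koszulChains L p j)
    ((koszulD k n M).restrictScalars k)]
  have h := Submodule.finrank_quotient_add_finrank
    ((koszulBoundaries L p j).submoduleOf (koszulCycles (n := n) L p j))
  rw [(Submodule.submoduleOfEquivOfLe (koszulBoundaries_le_koszulCycles hL p j)).finrank_eq] at h
  unfold koszulRank koszulDRank
  change _ + Module.finrank k (koszulBoundaries (n := n) L p j) =
    Module.finrank k (koszulCycles (n := n) L p j) at h
  change _ + _ + Module.finrank k (koszulBoundaries (n := n) L p j) =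
    _ + Module.finrank k (koszulCycles (n := n) L p j)
  omega

end KoszulNumerics

/-! ### Self-duality of the Koszul complex of a Frobenius algebra. -/

section Duality

variable {k : Type*} [Field k] {n : ℕ}
variable {A : Type*} [CommRing A] [Algebra k A]

/-- The pairing of Koszul chains induced by a functional on the algebra. -/
noncomputable def koszulPairing (n : ℕ) (φ : A →ₗ[k] k) :
    (Finset (Fin n) → A) →ₗ[k] (Finset (Fin n) → A) →ₗ[k] k :=
  LinearMap.mk₂ k (fun f g => ∑ S, φ (f S * g Sᶜ))
    (fun f f' g => by simp [add_mul, Finset.sum_add_distrib])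
    (fun c f g => by simp [Finset.mul_sum])
    (fun f g g' => by simp [mul_add, Finset.sum_add_distrib])
    (fun c f g => by simp [Finset.mul_sum])

theorem koszulPairing_apply (φ : A →ₗ[k] k) (f g : Finset (Fin n) → A) :
    koszulPairing n φ f g = ∑ S, φ (f S * g Sᶜ) := rfl

variable [Algebra (MvPolynomial (Fin n) k) A]

/-- Both sides sum φ(x_s f(S) g(Sᶜ ∪ {s})) over pairs s ∈ S; the left one is indexed by T = S \ {s}.
-/
theorem koszulPairing_koszulD (φ : A →ₗ[k] k) (f g : Finset (Fin n) → A) :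
    koszulPairing n φ (koszulD k n A f) g = koszulPairing n φ f (koszulD k n A g) := by
  rw [koszulPairing_apply, koszulPairing_apply]
  simp only [koszulD_apply, Finset.sum_mul, Finset.mul_sum, map_sum]
  rw [Finset.sum_sigma', Finset.sum_sigma']
  refine Finset.sum_bij' (fun x _ => ⟨insert x.2 x.1, x.2⟩) (fun x _ => ⟨x.1.erase x.2, x.2⟩)
    ?_ ?_ ?_ ?_ ?_
  · rintro ⟨T, s⟩ _
    simp
  · rintro ⟨S, s⟩ _
    simp
  · rintro ⟨T, s⟩ h
    simp only [Finset.mem_sigma, Finset.mem_univ, Finset.mem_compl, true_and] at h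
    simp [Finset.erase_insert h]
  · rintro ⟨S, s⟩ h
    simp only [Finset.mem_sigma, Finset.mem_univ, Finset.mem_compl, true_and, not_not] at h
    simp [Finset.insert_erase h]
  · rintro ⟨T, s⟩ h
    simp only [Finset.mem_sigma, Finset.mem_univ, Finset.mem_compl, true_and] at h
    have : insert s (insert s T)ᶜ = Tᶜ := by
      rw [Finset.compl_insert, Finset.insert_erase (Finset.mem_compl.2 h)]
    simp only [this]
    rw [smul_mul_assoc, mul_smul_comm]

variable [IsScalarTower k (MvPolynomial (Fin n) k) A]

/-- A functional whose associated pairing is perfect on complementary degrees with sum three. -/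
def IsFrobenius (L : ℤ → Submodule k A) (φ : A →ₗ[k] k) : Prop :=
  ∀ (e : ℤ), ∀ x ∈ L e, x ≠ 0 → ∃ y ∈ L (3 - e), φ (x * y) ≠ 0

theorem IsFrobenius.exists_koszulPairing_ne_zero {L : ℤ → Submodule k A} {φ : A →ₗ[k] k}
    (hφ : IsFrobenius L φ) {p q : ℕ} (hpq : p + q = n) {j : ℤ} {f : Finset (Fin n) → A}
    (hf : f ∈ koszulChains L p j) (hf0 : f ≠ 0) :
    ∃ g ∈ koszulChains L q (n + 3 - j), koszulPairing n φ f g ≠ 0 := by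
  obtain ⟨S, hS⟩ := Function.ne_iff.1 hf0
  have hcard : S.card = p := by
    by_contra h
    exact hS (apply_eq_zero_of_mem_koszulChains hf h)
  obtain ⟨y, hy, hxy⟩ := hφ _ _ ((mem_koszulChains.1 hf S).1 hcard) hS
  classical
  refine ⟨Pi.single Sᶜ y, mem_koszulChains.2 fun T => ⟨fun hT => ?_, fun hT => ?_⟩, ?_⟩
  · by_cases h : T = Sᶜ
    · subst h
      rw [Pi.single_eq_same]
      convert hy using 2
      rw [← hpq]
      push_cast
      ring
    · rw [Pi.single_eq_of_ne h]
      exact Submodule.zero_mem _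
  · refine Pi.single_eq_of_ne (fun h => hT ?_) _
    rw [h, Finset.card_compl, Fintype.card_fin, hcard]
    omega
  · rw [koszulPairing_apply, Finset.sum_eq_single S, Pi.single_eq_same]
    · exact hxy
    · intro T _ hT
      rw [Pi.single_eq_of_ne (fun h => hT (compl_injective h)), mul_zero, map_zero]
    · simp

/-- The bilinear form given by the pairing and the Koszul differential. -/
noncomputable def koszulForm (n : ℕ) {A : Type*} [CommRing A] [Algebra (MvPolynomial (Fin n) k) A]
    [Algebra k A] [IsScalarTower k (MvPolynomial (Fin n) k) A] (φ : A →ₗ[k] k)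
    (P Q : Submodule k (Finset (Fin n) → A)) :
    P →ₗ[k] Q →ₗ[k] k :=
  let D : (Finset (Fin n) → A) →ₗ[k] (Finset (Fin n) → A) := (koszulD k n A).restrictScalars k
  ((koszulPairing n φ).comp D).domRestrict₁₂ P Q

theorem koszulForm_apply (φ : A →ₗ[k] k) {P Q : Submodule k (Finset (Fin n) → A)} (f : P)
    (g : Q) : koszulForm n φ P Q f g = koszulPairing n φ (koszulD k n A f.1) g.1 := rfl

/-- The chain pairing is nondegenerate, so the left radical of ⟨df, g⟩ is exactly the kernel of d.
-/
theorem IsFrobenius.finrank_range_koszulForm [FiniteDimensional k A] {L : ℤ → Submodule k A}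
    {φ : A →ₗ[k] k} (hφ : IsFrobenius L φ) (hL : RespectsDegrees n L) {p q : ℕ}
    (hpq : p + q = n + 1) (j : ℤ) :
    Module.finrank k (LinearMap.range
      (koszulForm n φ (koszulChains L p j) (koszulChains L q (n + 3 - j)))) =
      koszulDRank n L p j := by
  have h1 := LinearMap.finrank_range_add_finrank_ker
    (koszulForm n φ (koszulChains L p j) (koszulChains L q (n + 3 - j)))
  have h2 := LinearMap.finrank_range_add_finrank_ker
    (((koszulD k n A).restrictScalars k).domRestrict (koszulChains L p j))
  have hker : LinearMap.ker (koszulForm n φ (koszulChains L p j)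
      (koszulChains L q (n + 3 - j))) =
      LinearMap.ker (((koszulD k n A).restrictScalars k).domRestrict (koszulChains L p j)) := by
    ext f
    rw [LinearMap.mem_ker, LinearMap.mem_ker]
    change _ ↔ koszulD k n A f.1 = 0
    constructor
    · intro h
      by_contra hne
      obtain _ | p := p
      · exact hne (koszulD_eq_zero_of_mem_koszulChains_zero f.2)
      · obtain ⟨g, hg, hfg⟩ := hφ.exists_koszulPairing_ne_zero (p := p) (q := q) (by omega)
          (koszulD_mem_koszulChains hL f.2) hne
        exact hfg (LinearMap.congr_fun h ⟨g, hg⟩)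
    · intro h
      ext g
      rw [koszulForm_apply, h, map_zero]
      rfl
  rw [hker] at h1
  rw [LinearMap.range_domRestrict] at h2
  unfold koszulDRank
  omega

/-- As d is self-adjoint, the forms for the two complementary bidegrees are transposes of each other
and have equal rank. -/
theorem IsFrobenius.koszulDRank_eq [FiniteDimensional k A] {L : ℤ → Submodule k A}
    {φ : A →ₗ[k] k} (hφ : IsFrobenius L φ) (hL : RespectsDegrees n L) {p q : ℕ}
    (hpq : p + q = n + 1) (j : ℤ) :
    koszulDRank n L p j = koszulDRank n L q (n + 3 - j) := by
  rw [← hφ.finrank_range_koszulForm hL hpq j, ← LinearMap.finrank_range_flip,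
    ← hφ.finrank_range_koszulForm hL (p := q) (q := p) (by omega) (n + 3 - j), sub_sub_cancel]
  have hflip : (koszulForm n φ (koszulChains L p j) (koszulChains L q (n + 3 - j))).flip =
      koszulForm n φ (koszulChains L q (n + 3 - j)) (koszulChains L p j) := ?_
  · rw [hflip]
  ext g f
  rw [LinearMap.flip_apply, koszulForm_apply, koszulForm_apply, koszulPairing_koszulD,
    koszulPairing_apply, koszulPairing_apply]
  refine Finset.sum_bij' (fun S _ => Sᶜ) (fun S _ => Sᶜ) (by simp) (by simp) (by simp) (by simp)
    fun S _ => ?_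
  rw [compl_compl, mul_comm]

theorem IsFrobenius.finrank_eq [FiniteDimensional k A] {L : ℤ → Submodule k A}
    {φ : A →ₗ[k] k} (hφ : IsFrobenius L φ) (e : ℤ) :
    Module.finrank k (L e) = Module.finrank k (L (3 - e)) := by
  have h : ∀ e, Module.finrank k (L e) ≤ Module.finrank k (L (3 - e)) := fun e => by
    -- The pairing embeds each piece into the dual of the complementary one; using this twice gives
    -- equality.
    let B : L e →ₗ[k] Module.Dual k (L (3 - e)) :=
      ((LinearMap.mul k A).compr₂ φ).domRestrict₁₂ (L e) (L (3 - e))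
    have hB : Function.Injective B := by
      rw [← LinearMap.ker_eq_bot, Submodule.eq_bot_iff]
      intro x hx
      by_contra hne
      obtain ⟨y, hy, hxy⟩ := hφ e x x.2 (fun h => hne (Subtype.ext h))
      exact hxy (LinearMap.congr_fun hx ⟨y, hy⟩)
    rw [← Subspace.dual_finrank_eq (V := L (3 - e))]
    exact LinearMap.finrank_le_finrank_of_injective hB
  refine le_antisymm (h e) ?_
  have := h (3 - e)
  rwa [sub_sub_cancel] at this

/-- Duality for Koszul homology. -/
theorem IsFrobenius.koszulRank_eq [CharP k 2] [FiniteDimensional k A] {L : ℤ → Submodule k A}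
    {φ : A →ₗ[k] k} (hφ : IsFrobenius L φ) (hL : RespectsDegrees n L) {p q : ℕ}
    (hpq : p + q = n) (j : ℤ) :
    koszulRank n L p j = koszulRank n L q (n + 3 - j) := by
  have h1 := koszulRank_add_koszulDRank hL p j
  have h2 := koszulRank_add_koszulDRank hL q (n + 3 - j)
  rw [hφ.koszulDRank_eq hL (p := p) (q := q + 1) (by omega),
    hφ.koszulDRank_eq hL (p := p + 1) (q := q) (by omega), hφ.finrank_eq,
    show (3 - (j - p) : ℤ) = n + 3 - j - q by rw [← hpq]; push_cast; ring,
    show n.choose p = n.choose q from Nat.choose_symm_of_eq_add (by omega)] at h1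
  omega

/-- The middle Koszul differential has even rank in characteristic two. -/
theorem IsFrobenius.even_koszulDRank [CharP k 2] [FiniteDimensional k A] {L : ℤ → Submodule k A}
    {φ : A →ₗ[k] k} (hφ : IsFrobenius L φ) (hL : RespectsDegrees n L) {m : ℕ}
    (hm : 1 ≤ m) (hmn : n = 2 * m + 1) :
    Even (koszulDRank n L (m + 1) (m + 2)) := by
  rw [← hφ.finrank_range_koszulForm hL (p := m + 1) (q := m + 1) (by omega),
    show ((n : ℤ) + 3 - (m + 2)) = m + 2 by rw [hmn]; push_cast; ring]
  refine LinearMap.IsAlt.even_finrank_range fun f => ?_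
  have hf := fun S => apply_eq_zero_of_mem_koszulChains (S := S) f.2
  rw [koszulForm_apply, koszulPairing_apply]
  simp only [koszulD_apply, Finset.sum_mul, map_sum]
  rw [Finset.sum_sigma']
  have hterm : ∀ x : (_ : Finset (Fin n)) × Fin n, x ∈ Finset.univ.sigma (fun T => Tᶜ) →
      insert x.2 (insert x.2 x.1)ᶜ = x.1ᶜ := by
    rintro ⟨T, s⟩ h
    simp only [Finset.mem_sigma, Finset.mem_univ, Finset.mem_compl, true_and] at h
    rw [Finset.compl_insert, Finset.insert_erase (Finset.mem_compl.2 h)]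
  -- A term of ⟨df, f⟩ is φ(x_s f(S) f(S')) with S = T ∪ {s} and S' = Tᶜ. The involution exchanges S
  -- and S', and commutativity makes the two terms equal, so they cancel in characteristic two.
  refine Finset.sum_involution (fun x _ => ⟨(insert x.2 x.1)ᶜ, x.2⟩) ?_ ?_ ?_ ?_
  · rintro ⟨T, s⟩ h
    have := hterm _ h
    simp only at this ⊢
    rw [this, compl_compl, smul_mul_assoc, smul_mul_assoc, mul_comm, CharTwo.add_self_eq_zero]
  · rintro ⟨T, s⟩ h hne heq
    simp only [Sigma.mk.injEq, heq_eq_eq, and_true] at heq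
    simp only [Finset.mem_sigma, Finset.mem_univ, Finset.mem_compl, true_and] at h
    have h1 : (insert s T).card = m + 1 := by
      by_contra hc
      rw [hf _ hc, smul_zero, zero_mul, map_zero] at hne
      exact hne rfl
    -- A fixed point would have S = S' = {s}, whereas S has m + 1 ≥ 2 elements.
    have hT : T = ∅ := Finset.eq_empty_of_forall_notMem fun t ht => by
      rw [← heq, Finset.mem_compl] at ht
      exact ht (Finset.mem_insert_of_mem (by rwa [← heq, Finset.mem_compl]))
    rw [hT, insert_empty_eq, Finset.card_singleton] at h1
    omega
  · rintro ⟨T, s⟩ h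
    simp
  · rintro ⟨T, s⟩ h
    have := hterm _ h
    simp only at this ⊢
    rw [this, compl_compl]

end Duality

/-! ### The graded algebra R/I and its Frobenius functional. -/

section QuotientAlgebra

variable {k : Type*} [Field k] {n : ℕ}

theorem mem_ideal_of_constantCoeff_eq_zero (J : Ideal (MvPolynomial (Fin n) k))
    (hJ : ∀ s, X s ∈ J) {p : MvPolynomial (Fin n) k} (hp : constantCoeff p = 0) : p ∈ J := by
  rw [p.as_sum]
  refine Ideal.sum_mem _ fun u hu => ?_
  obtain ⟨s, hs⟩ : ∃ s, u s ≠ 0 := by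
    by_contra! h
    rw [show u = 0 from Finsupp.ext h] at hu
    exact (mem_support_iff.1 hu) hp
  obtain ⟨q, hq⟩ := X_dvd_monomial.2 (Or.inr hs : coeff u p = 0 ∨ u s ≠ 0)
  rw [hq]
  exact J.mul_mem_right _ (hJ s)

variable {I : Ideal (MvPolynomial (Fin n) k)}

theorem mk_mem_quotientGraded {p : MvPolynomial (Fin n) k} {e : ℤ} (hp : IsFormOfDegree p e) :
    Ideal.Quotient.mk I p ∈ quotientGraded I e := mem_quotientGraded.2 ⟨p, hp, rfl⟩

theorem mul_mem_quotientGraded {d e : ℤ} {x y : MvPolynomial (Fin n) k ⧸ I}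
    (hx : x ∈ quotientGraded I d) (hy : y ∈ quotientGraded I e) :
    x * y ∈ quotientGraded I (d + e) := by
  obtain ⟨p, hp, rfl⟩ := mem_quotientGraded.1 hx
  obtain ⟨q, hq, rfl⟩ := mem_quotientGraded.1 hy
  rw [← map_mul]
  exact mk_mem_quotientGraded (hp.mul hq)

theorem X_smul_eq (s : Fin n) (x : MvPolynomial (Fin n) k ⧸ I) :
    (X s : MvPolynomial (Fin n) k) • x = Ideal.Quotient.mk I (X s) * x := by
  obtain ⟨q, rfl⟩ := Ideal.Quotient.mk_surjective x
  rfl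

theorem respectsDegrees_quotientGraded : RespectsDegrees n (quotientGraded I) := by
  intro e s x hx
  rw [X_smul_eq, add_comm]
  exact mul_mem_quotientGraded (mk_mem_quotientGraded (isFormOfDegree_X s)) hx

theorem quotientGraded_of_neg {e : ℤ} (he : e < 0) : quotientGraded I e = ⊥ := by
  rw [quotientGraded, formsOfDegree_of_neg he, Submodule.map_bot]

theorem finrank_quotientGraded_natCast (j : ℕ) :
    Module.finrank k (quotientGraded I j) = hilbertFunction I j := by
  rw [quotientGraded, formsOfDegree_natCast, hilbertFunction]

theorem eq_zero_of_mem_quotientGraded (hI : I.IsHomogeneous (homogeneousSubmodule (Fin n) k))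
    {d e : ℤ} (hde : d ≠ e) {x : MvPolynomial (Fin n) k ⧸ I} (hd : x ∈ quotientGraded I d)
    (he : x ∈ quotientGraded I e) : x = 0 := by
  obtain ⟨p, hp, rfl⟩ := mem_quotientGraded.1 hd
  obtain ⟨q, hq, hpq⟩ := mem_quotientGraded.1 he
  have := hI.formComponent_mem (Ideal.Quotient.eq.1 hpq) d
  rw [map_sub, hp.formComponent_eq, hq.formComponent_eq_zero hde.symm, zero_sub] at this
  rw [Ideal.Quotient.eq_zero_iff_mem]
  exact I.neg_mem_iff.1 this

/-- A monomial of positive degree is divisible by a variable, so the piece of degree e + 1 is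
spanned by the products x_s·y with y of degree e. -/
theorem quotientGraded_succ_le {e : ℤ} (he : 0 ≤ e) (P : Submodule k (MvPolynomial (Fin n) k ⧸ I))
    (hP : ∀ s : Fin n, ∀ x ∈ quotientGraded I e, (X s : MvPolynomial (Fin n) k) • x ∈ P) :
    quotientGraded I (e + 1) ≤ P := by
  intro x hx
  obtain ⟨p, hp, rfl⟩ := mem_quotientGraded.1 hx
  rw [p.as_sum, map_sum]
  refine Submodule.sum_mem _ fun u hu => ?_
  have hdeg := hp u hu
  obtain ⟨s, hs⟩ : ∃ s, u s ≠ 0 := by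
    by_contra! h
    rw [show u = 0 from Finsupp.ext h, map_zero] at hdeg
    norm_num at hdeg
    omega
  have hle : Finsupp.single s 1 ≤ u := Finsupp.single_le_iff.2 (Nat.one_le_iff_ne_zero.2 hs)
  have hmon : monomial u (coeff u p) =
      X s * monomial (u - Finsupp.single s 1) (coeff u p) := by
    rw [X, monomial_mul, one_mul, add_tsub_cancel_of_le hle]
  rw [hmon, map_mul, ← X_smul_eq]
  refine hP s _ (mk_mem_quotientGraded ?_)
  intro v hv
  have hv' := support_monomial_subset hv
  rw [Finset.mem_singleton] at hv'
  subst hv'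
  have h2 := congrArg Finsupp.degree (add_tsub_cancel_of_le hle)
  rw [map_add, Finsupp.degree_single] at h2
  omega

theorem quotient_isNilpotent_of_constantCoeff_eq_zero (h4 : ∀ e : ℤ, 4 ≤ e → quotientGraded I e = ⊥)
    {p : MvPolynomial (Fin n) k} (hp : constantCoeff p = 0) :
    IsNilpotent (Ideal.Quotient.mk I p) := by
  have h : p ∈ (nilradical (MvPolynomial (Fin n) k ⧸ I)).comap (Ideal.Quotient.mk I) := by
    refine mem_ideal_of_constantCoeff_eq_zero _ (fun s => ?_) hp
    rw [Ideal.mem_comap, mem_nilradical]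
    refine ⟨4, ?_⟩
    have h1 : Ideal.Quotient.mk I (X s) ∈ quotientGraded I 1 :=
      mk_mem_quotientGraded (isFormOfDegree_X s)
    have h := mul_mem_quotientGraded (mul_mem_quotientGraded h1 h1) (mul_mem_quotientGraded h1 h1)
    rw [h4 _ (by norm_num), Submodule.mem_bot] at h
    rw [← h]
    ring
  rwa [Ideal.mem_comap, mem_nilradical] at h

theorem constantCoeff_eq_zero_or_isUnit (h4 : ∀ e : ℤ, 4 ≤ e → quotientGraded I e = ⊥)
    (p : MvPolynomial (Fin n) k) :
    constantCoeff p = 0 ∨ IsUnit (Ideal.Quotient.mk I p) := by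
  by_cases hc : constantCoeff p = 0
  · exact Or.inl hc
  · right
    have hn := quotient_isNilpotent_of_constantCoeff_eq_zero h4
      (p := p - C (constantCoeff p)) (by simp)
    have hu : IsUnit (Ideal.Quotient.mk I (C (constantCoeff p))) :=
      ((isUnit_iff_ne_zero.2 hc).map C).map _
    have := hn.isUnit_add_left_of_commute hu (Commute.all _ _)
    rwa [← map_add, add_sub_cancel] at this

theorem isLocalRing_quotient (hI1 : I ≠ ⊤) (h4 : ∀ e : ℤ, 4 ≤ e → quotientGraded I e = ⊥) :
    IsLocalRing (MvPolynomial (Fin n) k ⧸ I) := by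
  have := Ideal.Quotient.nontrivial_iff.2 hI1
  refine IsLocalRing.of_isUnit_or_isUnit_one_sub_self fun a => ?_
  obtain ⟨p, rfl⟩ := Ideal.Quotient.mk_surjective a
  rcases constantCoeff_eq_zero_or_isUnit h4 p with hp | hp
  · right
    exact (quotient_isNilpotent_of_constantCoeff_eq_zero h4 hp).isUnit_one_sub
  · exact Or.inl hp

/-- A graded Artinian Gorenstein quotient with socle in degree three has a Frobenius functional. -/
theorem exists_isFrobenius (hI : I.IsHomogeneous (homogeneousSubmodule (Fin n) k)) (hI1 : I ≠ ⊤)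
    (hArt : IsArtinianRing (MvPolynomial (Fin n) k ⧸ I))
    (hGor : IsGorensteinRing (MvPolynomial (Fin n) k ⧸ I))
    (h3 : Module.finrank k (quotientGraded I 3) = 1)
    (h4 : ∀ e : ℤ, 4 ≤ e → quotientGraded I e = ⊥) :
    ∃ φ : (MvPolynomial (Fin n) k ⧸ I) →ₗ[k] k, IsFrobenius (quotientGraded I) φ := by
  have := isLocalRing_quotient hI1 h4
  have hmax : ∀ z : MvPolynomial (Fin n) k ⧸ I,
      (∀ s : Fin n, (X s : MvPolynomial (Fin n) k) • z = 0) →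
      ∀ p, constantCoeff p = 0 → Ideal.Quotient.mk I p * z = 0 := by
    intro z hz p hp
    have h : p ∈ (Submodule.annihilator (Ideal.span {z})).comap (Ideal.Quotient.mk I) := by
      refine mem_ideal_of_constantCoeff_eq_zero _ (fun s => ?_) hp
      rw [Ideal.mem_comap, Submodule.mem_annihilator_span_singleton, smul_eq_mul, ← X_smul_eq]
      exact hz s
    rwa [Ideal.mem_comap, Submodule.mem_annihilator_span_singleton] at h
  have hmax' : ∀ z : MvPolynomial (Fin n) k ⧸ I,
      (∀ s : Fin n, (X s : MvPolynomial (Fin n) k) • z = 0) →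
      ∀ a ∈ IsLocalRing.maximalIdeal (MvPolynomial (Fin n) k ⧸ I), a * z = 0 := by
    intro z hz a ha
    obtain ⟨p, rfl⟩ := Ideal.Quotient.mk_surjective a
    refine hmax z hz p ((constantCoeff_eq_zero_or_isUnit h4 p).resolve_right ?_)
    simpa using ha
  obtain ⟨⟨t, ht⟩, ht0, htspan⟩ := finrank_eq_one_iff'.1 h3
  have ht0' : t ≠ 0 := fun h => ht0 (Subtype.ext h)
  have hts : ∀ s : Fin n, (X s : MvPolynomial (Fin n) k) • t = 0 := fun s => by
    have := respectsDegrees_quotientGraded 3 s t ht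
    rwa [h4 _ (by norm_num), Submodule.mem_bot] at this
  -- A nonzero socle element z of degree e would have t as a multiple, in fact a scalar multiple,
  -- which puts t in degrees e and 3 at once.
  have hsoc : ∀ e : ℤ, e ≠ 3 → ∀ z ∈ quotientGraded I e,
      (∀ s : Fin n, (X s : MvPolynomial (Fin n) k) • z = 0) → z = 0 := by
    intro e he z hz hzs
    by_contra hz0
    obtain ⟨a, ha⟩ := hGor.exists_mul_eq hz0 ht0' (hmax' z hzs) (hmax' t hts)
    obtain ⟨p, rfl⟩ := Ideal.Quotient.mk_surjective a
    have h1 := hmax z hzs (p - C (constantCoeff p)) (by simp)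
    rw [map_sub, sub_mul, sub_eq_zero, ← ha] at h1
    refine ht0' (eq_zero_of_mem_quotientGraded hI he ?_ ht)
    rw [h1, show Ideal.Quotient.mk I (C (constantCoeff p)) * z = constantCoeff p • z from
      (Algebra.smul_def (constantCoeff p) z).symm]
    exact Submodule.smul_mem _ _ hz
  -- Outside degree three some variable does not kill x, so x can be multiplied up until degree
  -- three is reached; d bounds the distance to degree four, where everything vanishes.
  have hex : ∀ (d : ℕ) (e : ℤ), 4 - e ≤ d → ∀ x ∈ quotientGraded I e, x ≠ 0 →
      ∃ y ∈ quotientGraded I (3 - e), x * y ≠ 0 := by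
    intro d
    induction d with
    | zero =>
      intro e he x hx hx0
      rw [h4 e (by simpa using he), Submodule.mem_bot] at hx
      exact absurd hx hx0
    | succ d ih =>
      intro e he x hx hx0
      by_cases he3 : e = 3
      · subst he3
        refine ⟨1, ?_, by rwa [mul_one]⟩
        rw [← map_one (Ideal.Quotient.mk I), sub_self]
        exact mk_mem_quotientGraded isFormOfDegree_one
      · obtain ⟨s, hs⟩ : ∃ s : Fin n, (X s : MvPolynomial (Fin n) k) • x ≠ 0 := by
          by_contra! h
          exact hx0 (hsoc e he3 x hx h)
        obtain ⟨y, hy, hxy⟩ := ih (e + 1) (by push_cast at he; omega) _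
          (respectsDegrees_quotientGraded e s x hx) hs
        refine ⟨(X s : MvPolynomial (Fin n) k) • y, ?_, ?_⟩
        · have := respectsDegrees_quotientGraded _ s y hy
          rwa [show 3 - (e + 1) + 1 = 3 - e by ring] at this
        · rwa [mul_smul_comm, ← smul_mul_assoc]
  -- Only products of degree three are ever tested, so the values of φ in other degrees are
  -- irrelevant.
  obtain ⟨φ, hφ⟩ : ∃ φ : Module.Dual k (MvPolynomial (Fin n) k ⧸ I), φ t ≠ 0 := by
    by_contra! h
    exact ht0' ((Module.forall_dual_apply_eq_zero_iff k t).1 h)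
  refine ⟨φ, fun e x hx hx0 => ?_⟩
  obtain ⟨y, hy, hxy⟩ := hex (4 - e).toNat e (Int.self_le_toNat _) x hx hx0
  refine ⟨y, hy, ?_⟩
  have hmem := mul_mem_quotientGraded hx hy
  rw [add_sub_cancel] at hmem
  obtain ⟨c, hc⟩ := htspan ⟨x * y, hmem⟩
  have hc' : c • t = x * y := congrArg Subtype.val hc
  rw [← hc', map_smul, smul_eq_mul]
  refine mul_ne_zero (fun h => hxy ?_) hφ
  rw [← hc', h, zero_smul]

end QuotientAlgebra

/-! ### Parity of binomial coefficients. -/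

section Parity

theorem odd_choose_two_pow_sub_one (a j : ℕ) (hj : j < 2 ^ a) : Odd ((2 ^ a - 1).choose j) := by
  induction a generalizing j with
  | zero => simp [show j = 0 by simpa using hj]
  | succ a ih =>
    have h := Choose.choose_modEq_choose_mod_mul_choose_div_nat (n := 2 ^ (a + 1) - 1) (k := j)
      (p := 2)
    have hpos := Nat.one_le_two_pow (n := a)
    rw [pow_succ] at hj h ⊢
    rw [show (2 ^ a * 2 - 1) % 2 = 1 by omega, show (2 ^ a * 2 - 1) / 2 = 2 ^ a - 1 by omega] at h
    have h1 : Nat.choose 1 (j % 2) = 1 := by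
      rcases Nat.mod_two_eq_zero_or_one j with h | h <;> simp [h]
    rw [h1, one_mul] at h
    rw [Nat.odd_iff, h, ← Nat.odd_iff]
    exact ih _ (by omega)

theorem even_choose_of_even_of_odd {q s : ℕ} (hq : q % 2 = 0) (hs : s % 2 = 1) :
    Even (q.choose s) := by
  have h := Choose.choose_modEq_choose_mod_mul_choose_div_nat (n := q) (k := s) (p := 2)
  rw [hq, hs, Nat.choose_zero_succ, zero_mul] at h
  exact Nat.even_iff.2 h

theorem choose_mod_two_of_even_or_odd {n : ℕ} (hn : n % 2 = 1) (m : ℕ) :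
    n.choose m ≡ (n / 2).choose (m / 2) [MOD 2] := by
  have h := Choose.choose_modEq_choose_mod_mul_choose_div_nat (n := n) (k := m) (p := 2)
  have h1 : Nat.choose 1 (m % 2) = 1 := by
    rcases Nat.mod_two_eq_zero_or_one m with h | h <;> simp [h]
  rwa [hn, h1, one_mul] at h

/-- In binary, n = 1…101 has its only zero in the twos place. There m = 1…10 has a one, while m - 1
= 2^{ℓ-1} - 3 has a zero; Lucas' theorem concludes. -/
theorem parity_of_choose {ℓ n m : ℕ} (hℓ : 3 ≤ ℓ) (hn : n = 2 ^ ℓ - 3) (hm : m = (n - 1) / 2) :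
    Even (n.choose m) ∧ Odd (n.choose (m - 1)) := by
  obtain ⟨a, rfl⟩ := Nat.exists_eq_add_of_le hℓ
  have hpos := Nat.one_le_two_pow (n := a)
  have hp : 2 ^ (3 + a) = 8 * 2 ^ a := by rw [pow_add]; norm_num
  rw [hp] at hn
  have hn2 : n / 2 = 4 * 2 ^ a - 2 := by omega
  constructor
  · rw [Nat.even_iff, choose_mod_two_of_even_or_odd (by omega) m, ← Nat.even_iff]
    exact even_choose_of_even_of_odd (by omega) (by omega)
  · rw [Nat.odd_iff, choose_mod_two_of_even_or_odd (by omega) (m - 1)]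
    have h := Choose.choose_modEq_choose_mod_mul_choose_div_nat (n := n / 2) (k := (m - 1) / 2)
      (p := 2)
    rw [show n / 2 % 2 = 0 by omega, show (m - 1) / 2 % 2 = 0 by omega, Nat.choose_zero_right,
      one_mul, show n / 2 / 2 = 2 ^ (a + 1) - 1 by omega] at h
    rw [h, ← Nat.odd_iff]
    exact odd_choose_two_pow_sub_one _ _ (by omega)

end Parity

/-! ### Lower bounds for ranks of Koszul differentials. -/

section LowerBound

variable {k : Type*} [Field k] {n : ℕ}
variable {I : Ideal (MvPolynomial (Fin n) k)}

theorem finrank_le_koszulDRank [FiniteDimensional k (MvPolynomial (Fin n) k ⧸ I)]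
    {L : ℤ → Submodule k (MvPolynomial (Fin n) k ⧸ I)} {p : ℕ} {j : ℤ} {W : Type*}
    [AddCommGroup W] [Module k W]
    (Ψ : W →ₗ[k] (Finset (Fin n) → MvPolynomial (Fin n) k ⧸ I))
    (hΨ : ∀ w, Ψ w ∈ koszulChains L p j) (hinj : ∀ w, koszulD k n _ (Ψ w) = 0 → w = 0) :
    Module.finrank k W ≤ koszulDRank n L p j := by
  let D : (Finset (Fin n) → MvPolynomial (Fin n) k ⧸ I) →ₗ[k]
    (Finset (Fin n) → MvPolynomial (Fin n) k ⧸ I) := (koszulD k n _).restrictScalars k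
  refine LinearMap.finrank_le_finrank_of_injective
    (f := (D.comp Ψ).codRestrict ((koszulChains L p j).map D) fun w => ⟨Ψ w, hΨ w, rfl⟩) ?_
  rw [← LinearMap.ker_eq_bot, Submodule.eq_bot_iff]
  intro w hw
  exact hinj w (congrArg Subtype.val hw)

/-- Koszul chains with values in the line spanned by `v`, supported on a given set of subsets. -/
noncomputable def lineChains (v : MvPolynomial (Fin n) k ⧸ I) (P : Finset (Finset (Fin n))) :
    (P → k) →ₗ[k] (Finset (Fin n) → MvPolynomial (Fin n) k ⧸ I) where
  toFun c S := if h : S ∈ P then c ⟨S, h⟩ • v else 0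
  map_add' c c' := by
    ext S
    by_cases h : S ∈ P <;> simp [h, add_smul]
  map_smul' a c := by
    ext S
    by_cases h : S ∈ P <;> simp [h, mul_smul]

theorem lineChains_of_mem (v : MvPolynomial (Fin n) k ⧸ I) {P : Finset (Finset (Fin n))}
    (c : P → k) {S : Finset (Fin n)} (h : S ∈ P) : lineChains v P c S = c ⟨S, h⟩ • v := dif_pos h

theorem lineChains_of_notMem (v : MvPolynomial (Fin n) k ⧸ I) {P : Finset (Finset (Fin n))}
    (c : P → k) {S : Finset (Fin n)} (h : S ∉ P) : lineChains v P c S = 0 := dif_neg h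

theorem lineChains_mem {L : ℤ → Submodule k (MvPolynomial (Fin n) k ⧸ I)} {p : ℕ} {j : ℤ}
    {v : MvPolynomial (Fin n) k ⧸ I} (hv : v ∈ L (j - p)) {P : Finset (Finset (Fin n))}
    (hP : ∀ S ∈ P, S.card = p) (c : P → k) : lineChains v P c ∈ koszulChains L p j := by
  refine mem_koszulChains.2 fun S => ⟨fun _ => ?_, fun hS => lineChains_of_notMem v c
    fun h => hS (hP S h)⟩
  by_cases h : S ∈ P
  · rw [lineChains_of_mem v c h]
    exact Submodule.smul_mem _ _ hv
  · rw [lineChains_of_notMem v c h]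
    exact Submodule.zero_mem _

theorem X_smul_lineChains (v : MvPolynomial (Fin n) k ⧸ I) (P : Finset (Finset (Fin n)))
    (c : P → k) (S : Finset (Fin n)) (s : Fin n) :
    (X s : MvPolynomial (Fin n) k) • lineChains v P c S =
      v * (if h : S ∈ P then c ⟨S, h⟩ • Ideal.Quotient.mk I (X s) else 0) := by
  by_cases h : S ∈ P
  · rw [lineChains_of_mem v c h, dif_pos h, X_smul_eq, mul_smul_comm, mul_smul_comm, mul_comm]
  · rw [lineChains_of_notMem v c h, dif_neg h, smul_zero, mul_zero]

/-- The Koszul differential of a chain with values in the line spanned by `v`. -/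
theorem koszulD_lineChains_mem (v : MvPolynomial (Fin n) k ⧸ I) (P : Finset (Finset (Fin n)))
    (c : P → k) (T : Finset (Fin n)) :
    koszulD k n _ (lineChains v P c) T ∈
      (quotientGraded I 1).map (LinearMap.mulLeft k v) := by
  rw [koszulD_apply]
  refine Submodule.sum_mem _ fun s _ => ⟨_, ?_, (X_smul_lineChains v P c _ s).symm⟩
  split_ifs
  · exact Submodule.smul_mem _ _ (mk_mem_quotientGraded (isFormOfDegree_X s))
  · exact Submodule.zero_mem _

theorem linearIndependent_mk_X (h1 : Module.finrank k (quotientGraded I 1) = n) :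
    LinearIndependent k fun s : Fin n => Ideal.Quotient.mk I (X s) := by
  rw [linearIndependent_iff_card_le_finrank_span, Fintype.card_fin]
  have hle : quotientGraded I 1 ≤
      Submodule.span k (Set.range fun s : Fin n => Ideal.Quotient.mk I (X s)) := by
    refine quotientGraded_succ_le le_rfl _ fun s x hx => ?_
    obtain ⟨p, hp, rfl⟩ := mem_quotientGraded.1 hx
    rw [hp.eq_C, X_smul_eq, mul_comm,
      show Ideal.Quotient.mk I (C (constantCoeff p)) * Ideal.Quotient.mk I (X s) =
        constantCoeff p • Ideal.Quotient.mk I (X s) from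
          (Algebra.smul_def (constantCoeff p) (Ideal.Quotient.mk I (X s))).symm]
    exact Submodule.smul_mem _ _ (Submodule.subset_span ⟨s, rfl⟩)
  have : FiniteDimensional k
      (Submodule.span k (Set.range fun s : Fin n => Ideal.Quotient.mk I (X s))) :=
    FiniteDimensional.span_of_finite k (Set.finite_range _)
  exact h1.symm.le.trans (Submodule.finrank_mono hle)

/-- On v⊗Λ^p the differential is injective: its value at S \ {s} is v times a linear form in which
x_s has coefficient c_S, and v cancels. It is used with v = 1 for the linear strand and with v of
degree one for the middle rank. -/
theorem choose_le_koszulDRank [FiniteDimensional k (MvPolynomial (Fin n) k ⧸ I)]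
    (h1 : Module.finrank k (quotientGraded I 1) = n) {p : ℕ} (hp : 1 ≤ p) {j : ℤ}
    {v : MvPolynomial (Fin n) k ⧸ I} (hv : v ∈ quotientGraded I (j - p))
    (hinj : ∀ y ∈ quotientGraded I 1, v * y = 0 → y = 0) :
    n.choose p ≤ koszulDRank n (quotientGraded I) p j := by
  have h := finrank_le_koszulDRank (lineChains v (Finset.powersetCard p Finset.univ))
    (lineChains_mem hv fun S hS => (Finset.mem_powersetCard.1 hS).2) ?_
  · rwa [Module.finrank_fintype_fun_eq_card, Fintype.card_coe, Finset.card_powersetCard,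
      Finset.card_univ, Fintype.card_fin] at h
  intro c hc
  ext ⟨S, hS⟩
  have hcard := (Finset.mem_powersetCard.1 hS).2
  obtain ⟨s, hs⟩ : S.Nonempty := Finset.card_pos.1 (by omega)
  have hT := congrFun hc (S.erase s)
  rw [koszulD_apply, Pi.zero_apply] at hT
  simp only [X_smul_lineChains] at hT
  rw [← Finset.mul_sum] at hT
  have hmem : ∀ t ∈ (S.erase s)ᶜ, insert t (S.erase s) ∈ Finset.powersetCard p Finset.univ := by
    intro t ht
    rw [Finset.mem_powersetCard_univ, Finset.card_insert_of_notMem (Finset.mem_compl.1 ht),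
      Finset.card_erase_of_mem hs, hcard]
    omega
  have h0 := hinj _ (Submodule.sum_mem _ fun t ht => by
    rw [dif_pos (hmem t ht)]
    exact Submodule.smul_mem _ _ (mk_mem_quotientGraded (isFormOfDegree_X t))) hT
  rw [Finset.sum_congr rfl (g := fun t => (if h : insert t (S.erase s) ∈
    Finset.powersetCard p Finset.univ then c ⟨_, h⟩ else 0) • Ideal.Quotient.mk I (X t))
    (fun t ht => by rw [dif_pos (hmem t ht), dif_pos (hmem t ht)])] at h0
  have h2 := linearIndependent_iff'.1 (linearIndependent_mk_X h1) _ _ h0 s (by simp)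
  rw [dif_pos (hmem s (by simp))] at h2
  simpa [Finset.insert_erase hs] using h2

theorem card_filter_mem_powersetCard (s : Fin n) (m : ℕ) :
    ((Finset.powersetCard (m + 1) (Finset.univ : Finset (Fin n))).filter (s ∈ ·)).card =
      (n - 1).choose m := by
  have h : (Finset.powersetCard m (Finset.univ.erase s)).card = (n - 1).choose m := by
    rw [Finset.card_powersetCard, Finset.card_erase_of_mem (Finset.mem_univ s), Finset.card_univ,
      Fintype.card_fin]
  rw [← h]
  refine Finset.card_nbij' (fun S => S.erase s) (fun T => insert s T) ?_ ?_ ?_ ?_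
  · intro S hS
    simp only [Finset.coe_filter, Finset.mem_powersetCard_univ, Set.mem_ofPred_eq] at hS
    rw [Finset.mem_coe, Finset.mem_powersetCard]
    exact ⟨Finset.erase_subset_erase _ (Finset.subset_univ _), by
      rw [Finset.card_erase_of_mem hS.2, hS.1, Nat.add_sub_cancel]⟩
  · intro T hT
    rw [Finset.mem_coe, Finset.mem_powersetCard] at hT
    have hs : s ∉ T := fun h => by simpa using hT.1 h
    simp [Finset.card_insert_of_notMem hs, hT.2]
  · intro S hS
    simp only [Finset.coe_filter, Finset.mem_powersetCard_univ, Set.mem_ofPred_eq] at hS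
    exact Finset.insert_erase hS.2
  · intro T hT
    rw [Finset.mem_coe, Finset.mem_powersetCard] at hT
    exact Finset.erase_insert fun h => by simpa using hT.1 h

theorem koszulD_lineChains_erase (v : MvPolynomial (Fin n) k ⧸ I) (s : Fin n) (m : ℕ)
    (c : (Finset.powersetCard (m + 1) (Finset.univ : Finset (Fin n))).filter (s ∈ ·) → k)
    {S : Finset (Fin n)}
    (hS : S ∈ (Finset.powersetCard (m + 1) (Finset.univ : Finset (Fin n))).filter (s ∈ ·)) :
    koszulD k n _ (lineChains v _ c) (S.erase s) =
      c ⟨S, hS⟩ • (X s : MvPolynomial (Fin n) k) • v := by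
  have hs := (Finset.mem_filter.1 hS).2
  rw [koszulD_apply, Finset.sum_eq_single_of_mem s (by simp)]
  · have h : insert s (S.erase s) = S := Finset.insert_erase hs
    rw [lineChains_of_mem v c (by rwa [h]), smul_comm]
    congr 2
    simp only [h]
  · intro t _ hts
    rw [lineChains_of_notMem, smul_zero]
    simp [hts.symm]

/-- Test on the chains v⊗e_S with s ∈ S together with w⊗e_S with t ∈ S. At S \ {t} the second family
contributes a multiple of x_t w alone, which is detected modulo v·A_1; once its coefficients vanish,
those of the first family are read off at S \ {s}. -/
theorem two_mul_choose_le_koszulDRank [FiniteDimensional k (MvPolynomial (Fin n) k ⧸ I)]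
    {m : ℕ} {v w : MvPolynomial (Fin n) k ⧸ I} (hv : v ∈ quotientGraded I 1)
    (hw : w ∈ quotientGraded I 1) {s t : Fin n} (hsv : (X s : MvPolynomial (Fin n) k) • v ≠ 0)
    (htw : (X t : MvPolynomial (Fin n) k) • w ∉
      (quotientGraded I 1).map (LinearMap.mulLeft k v)) :
    2 * (n - 1).choose m ≤ koszulDRank n (quotientGraded I) (m + 1) (m + 2) := by
  let P : Fin n → Finset (Finset (Fin n)) := fun s =>
    (Finset.powersetCard (m + 1) Finset.univ).filter (s ∈ ·)
  have hP : ∀ s, ∀ S ∈ P s, S.card = m + 1 := fun s S hS =>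
    Finset.mem_powersetCard_univ.1 (Finset.mem_filter.1 hS).1
  have he : ((m : ℤ) + 2 - ((m + 1 : ℕ) : ℤ)) = 1 := by push_cast; ring
  have h := finrank_le_koszulDRank (L := quotientGraded I) (p := m + 1) (j := m + 2)
    ((lineChains v (P s)).coprod (lineChains w (P t))) (fun c => ?_) ?_
  · rw [Module.finrank_prod, Module.finrank_fintype_fun_eq_card,
      Module.finrank_fintype_fun_eq_card, Fintype.card_coe, Fintype.card_coe,
      card_filter_mem_powersetCard, card_filter_mem_powersetCard] at h
    omega
  · exact Submodule.add_mem _ (lineChains_mem (by rwa [he]) (hP s) _)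
      (lineChains_mem (by rwa [he]) (hP t) _)
  · rintro ⟨c, d⟩ hcd
    rw [LinearMap.coprod_apply, map_add] at hcd
    have hd : d = 0 := by
      ext ⟨S, hS⟩
      by_contra hne
      have h1 := congrFun hcd (S.erase t)
      rw [Pi.add_apply, koszulD_lineChains_erase w t m d hS, Pi.zero_apply] at h1
      have h2 := Submodule.neg_mem _ (koszulD_lineChains_mem v (P s) c (S.erase t))
      rw [← eq_neg_of_add_eq_zero_right h1] at h2
      have h3 := Submodule.smul_mem _ (d ⟨S, hS⟩)⁻¹ h2
      rw [inv_smul_smul₀ hne] at h3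
      exact htw h3
    have hc : c = 0 := by
      ext ⟨S, hS⟩
      have h1 := congrFun hcd (S.erase s)
      rw [hd, map_zero, map_zero, add_zero, koszulD_lineChains_erase v s m c hS,
        Pi.zero_apply] at h1
      exact (smul_eq_zero.1 h1).resolve_right hsv
    rw [hc, hd]
    rfl

/-- The lower bound for the rank of the middle Koszul differential. -/
theorem choose_le_koszulDRank_middle [FiniteDimensional k (MvPolynomial (Fin n) k ⧸ I)]
    (h1 : Module.finrank k (quotientGraded I 1) = n)
    (h2 : Module.finrank k (quotientGraded I 2) = n) {m : ℕ} (hm : 1 ≤ m) (hmn : n = 2 * m + 1) :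
    n.choose (m - 1) ≤ koszulDRank n (quotientGraded I) (m + 1) (m + 2) := by
  have hne : ¬ quotientGraded I (1 + 1) ≤ ⊥ := fun h => by
    rw [one_add_one_eq_two, le_bot_iff] at h
    rw [h, finrank_bot] at h2
    omega
  obtain ⟨s, v, hv, hsv⟩ : ∃ s : Fin n, ∃ v ∈ quotientGraded I 1,
      (X s : MvPolynomial (Fin n) k) • v ≠ 0 := by
    by_contra! h
    exact hne (quotientGraded_succ_le zero_le_one _ fun s x hx => by
      rw [Submodule.mem_bot]
      exact h s x hx)
  obtain ⟨l, rfl⟩ : ∃ l, m = l + 1 := ⟨m - 1, by omega⟩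
  rw [Nat.add_sub_cancel]
  -- If v·A_1 exhausts A_2, equality of dimensions makes multiplication by v injective on A_1.
  -- Otherwise some product x_t w escapes v·A_1.
  by_cases hle : quotientGraded I (1 + 1) ≤ (quotientGraded I 1).map (LinearMap.mulLeft k v)
  · have hfin := finrank_map_add_finrank_inf_ker (quotientGraded I 1) (LinearMap.mulLeft k v)
    have hge := Submodule.finrank_mono hle
    rw [one_add_one_eq_two, h2] at hge
    rw [h1] at hfin
    have hbot := Submodule.finrank_eq_zero.1 (show Module.finrank k
      (quotientGraded I 1 ⊓ LinearMap.ker (LinearMap.mulLeft k v) : Submodule k _) = 0 by omega)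
    refine le_trans ?_ (choose_le_koszulDRank h1 (by omega) (v := v) ?_ fun y hy hvy => ?_)
    · calc n.choose l ≤ n.choose (n / 2) := Nat.choose_le_middle _ _
        _ = n.choose (l + 1 + 1) := by
          rw [show n / 2 = l + 1 by omega]
          exact Nat.choose_symm_of_eq_add (by omega)
    · convert hv using 2
      push_cast
      ring
    · have : y ∈ quotientGraded I 1 ⊓ LinearMap.ker (LinearMap.mulLeft k v) := ⟨hy, hvy⟩
      rwa [hbot, Submodule.mem_bot] at this
  · obtain ⟨t, w, hw, htw⟩ : ∃ t : Fin n, ∃ w ∈ quotientGraded I 1,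
        (X t : MvPolynomial (Fin n) k) • w ∉
          (quotientGraded I 1).map (LinearMap.mulLeft k v) := by
      by_contra! h
      exact hle (quotientGraded_succ_le zero_le_one _ h)
    refine le_trans ?_ (two_mul_choose_le_koszulDRank hv hw hsv htw)
    rw [show n - 1 = 2 * (l + 1) by omega, hmn]
    -- Pascal's rule writes C(2m+1, m-1) as C(2m, m-2) + C(2m, m-1), each at most the central C(2m,
    -- m); the case m = 1 is separate.
    rcases l with _ | l
    · simp
    · have ha := Nat.choose_le_centralBinom l (l + 1 + 1)
      have hb := Nat.choose_le_centralBinom (l + 1) (l + 1 + 1)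
      rw [Nat.choose_succ_succ, Nat.succ_eq_add_one]
      change _ ≤ 2 * Nat.centralBinom (l + 1 + 1)
      omega

end LowerBound

/-! ### The Betti table and its middle entry. -/

section BettiTable

variable {k : Type*} [Field k] {n : ℕ} {I : Ideal (MvPolynomial (Fin n) k)}

theorem koszulRank_quotientGraded_zero [CharP k 2]
    (hI : I.IsHomogeneous (homogeneousSubmodule (Fin n) k)) (hI1 : I ≠ ⊤) (j : ℤ) :
    koszulRank n (quotientGraded I) 0 j = if j = 0 then 1 else 0 := by
  let φ : (Fin 1 → MvPolynomial (Fin n) k) →ₗ[MvPolynomial (Fin n) k]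
    (MvPolynomial (Fin n) k ⧸ I) := I.mkQ.comp (LinearMap.proj 0)
  have hφ : gradedMap φ (freeGraded fun _ => 0) = quotientGraded I := by
    ext e x
    rw [mem_quotientGraded]
    constructor
    · rintro ⟨g, hg, rfl⟩
      exact ⟨g 0, by simpa using mem_freeGraded.1 hg 0, rfl⟩
    · rintro ⟨p, hp, rfl⟩
      exact ⟨fun _ => p, mem_freeGraded.2 fun _ => by simpa using hp, rfl⟩
  rw [← hφ, koszulRank_zero_gradedMap_freeGraded]
  · split_ifs with h <;> simp [h, eq_comm]
  · intro g hg a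
    rw [Subsingleton.elim a 0]
    exact constantCoeff_eq_zero_of_mem hI hI1 ((Submodule.Quotient.mk_eq_zero I).1 hg)

/-- The lower bound with v = 1 already fills the whole chain space A_0⊗Λ^p, which leaves nothing for
homology. -/
theorem koszulDRank_diagonal [CharP k 2] [FiniteDimensional k (MvPolynomial (Fin n) k ⧸ I)]
    (h0 : Module.finrank k (quotientGraded I 0) = 1)
    (h1 : Module.finrank k (quotientGraded I 1) = n) {p : ℕ} (hp : 1 ≤ p) :
    koszulDRank n (quotientGraded I) p p = n.choose p ∧
      koszulRank n (quotientGraded I) p p = 0 := by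
  have hle := choose_le_koszulDRank h1 hp (j := p) (v := 1) (by
    rw [sub_self, ← map_one (Ideal.Quotient.mk I)]
    exact mk_mem_quotientGraded isFormOfDegree_one) fun y _ hy => by rwa [one_mul] at hy
  have hadd := koszulRank_add_koszulDRank (respectsDegrees_quotientGraded (I := I)) p p
  rw [sub_self, h0, mul_one] at hadd
  omega

theorem koszulRank_eq_zero_of_le [CharP k 2] [FiniteDimensional k (MvPolynomial (Fin n) k ⧸ I)]
    (h0 : Module.finrank k (quotientGraded I 0) = 1)
    (h1 : Module.finrank k (quotientGraded I 1) = n) {p : ℕ} (hp : 1 ≤ p) {j : ℤ} (hj : j ≤ p) :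
    koszulRank n (quotientGraded I) p j = 0 := by
  rcases hj.eq_or_lt with rfl | hj
  · exact (koszulDRank_diagonal h0 h1 hp).2
  · have hadd := koszulRank_add_koszulDRank (respectsDegrees_quotientGraded (I := I)) p j
    rw [quotientGraded_of_neg (by omega), finrank_bot, mul_zero] at hadd
    omega

theorem koszulRank_eq_zero_of_lt [CharP k 2] [FiniteDimensional k (MvPolynomial (Fin n) k ⧸ I)]
    {p : ℕ} (hp : n < p) (j : ℤ) : koszulRank n (quotientGraded I) p j = 0 := by
  have hadd := koszulRank_add_koszulDRank (respectsDegrees_quotientGraded (I := I)) p j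
  rw [Nat.choose_eq_zero_of_lt hp, zero_mul] at hadd
  omega

/-- The shape of the Betti table. -/
theorem koszulRank_support [CharP k 2] [FiniteDimensional k (MvPolynomial (Fin n) k ⧸ I)]
    (hI : I.IsHomogeneous (homogeneousSubmodule (Fin n) k)) (hI1 : I ≠ ⊤)
    (h0 : Module.finrank k (quotientGraded I 0) = 1)
    (h1 : Module.finrank k (quotientGraded I 1) = n)
    {φ : (MvPolynomial (Fin n) k ⧸ I) →ₗ[k] k} (hφ : IsFrobenius (quotientGraded I) φ)
    {i : ℕ} {j : ℤ} (h : koszulRank n (quotientGraded I) i j ≠ 0) :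
    (i = 0 ∧ j = 0) ∨ (1 ≤ i ∧ i ≤ n - 1 ∧ (j = i + 1 ∨ j = i + 2)) ∨ (i = n ∧ j = n + 3) := by
  have hin : i ≤ n := not_lt.1 fun hlt => h (koszulRank_eq_zero_of_lt hlt j)
  have hdual := hφ.koszulRank_eq respectsDegrees_quotientGraded (p := i) (q := n - i) (by omega) j
  rcases Nat.eq_zero_or_pos i with rfl | hi
  · rw [koszulRank_quotientGraded_zero hI hI1] at h
    exact Or.inl ⟨rfl, by by_contra hj; exact h (if_neg hj)⟩
  · rcases hin.eq_or_lt with rfl | hlt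
    · rw [hdual, Nat.sub_self, koszulRank_quotientGraded_zero hI hI1] at h
      have : (i : ℤ) + 3 - j = 0 := by by_contra hj; exact h (if_neg hj)
      exact Or.inr (Or.inr ⟨rfl, by omega⟩)
    -- The vanishing for j ≤ i, applied to the entry and to its dual, leaves i < j < i + 3.
    · have hj1 : (i : ℤ) < j := not_le.1 fun hle => h (koszulRank_eq_zero_of_le h0 h1 hi hle)
      have hj2 : ((n - i : ℕ) : ℤ) < n + 3 - j := not_le.1 fun hle =>
        h (hdual.trans (koszulRank_eq_zero_of_le h0 h1 (by omega) hle))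
      exact Or.inr (Or.inl ⟨hi, by omega, by omega⟩)

/-- Here r is the rank of the differential entering A_2⊗Λ^m. The one leaving is dual to the linear
strand at m + 2, whose rank is C(n, m+2) = C(n, m-1). -/
theorem koszulRank_middle [CharP k 2] [FiniteDimensional k (MvPolynomial (Fin n) k ⧸ I)]
    (h0 : Module.finrank k (quotientGraded I 0) = 1)
    (h1 : Module.finrank k (quotientGraded I 1) = n)
    (h2 : Module.finrank k (quotientGraded I 2) = n)
    {φ : (MvPolynomial (Fin n) k ⧸ I) →ₗ[k] k} (hφ : IsFrobenius (quotientGraded I) φ)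
    {m : ℕ} (hm : 1 ≤ m) (hmn : n = 2 * m + 1) :
    ∃ r, Even r ∧ n.choose (m - 1) ≤ r ∧
      koszulRank n (quotientGraded I) m (m + 2) + n.choose (m - 1) + r = n * n.choose m := by
  refine ⟨_, hφ.even_koszulDRank respectsDegrees_quotientGraded hm hmn,
    choose_le_koszulDRank_middle h1 h2 hm hmn, ?_⟩
  have hadd := koszulRank_add_koszulDRank (respectsDegrees_quotientGraded (I := I)) m (m + 2)
  rw [hφ.koszulDRank_eq respectsDegrees_quotientGraded (p := m) (q := m + 2) (by omega),
    show ((n : ℤ) + 3 - (m + 2)) = ((m + 2 : ℕ) : ℤ) by rw [hmn]; push_cast; ring,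
    (koszulDRank_diagonal h0 h1 (by omega)).1, add_sub_cancel_left, h2,
    show n.choose (m + 2) = n.choose (m - 1) from Nat.choose_symm_of_eq_add (by omega)] at hadd
  rw [hadd, mul_comm]

end BettiTable

theorem mainTheorem5 {k : Type*} [Field k] [CharP k 2]
    (ℓ n m : ℕ) (hℓ : 3 ≤ ℓ) (hn : n = 2 ^ ℓ - 3) (hm : m = (n - 1) / 2)
    (I : Ideal (MvPolynomial (Fin n) k))
    (hI : I.IsHomogeneous (MvPolynomial.homogeneousSubmodule (Fin n) k))
    (hArt : IsArtinianRing (MvPolynomial (Fin n) k ⧸ I))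
    (hGor : IsGorensteinRing (MvPolynomial (Fin n) k ⧸ I))
    (h0 : hilbertFunction I 0 = 1) (h1 : hilbertFunction I 1 = n)
    (h2 : hilbertFunction I 2 = n) (h3 : hilbertFunction I 3 = 1)
    (h4 : ∀ j, 4 ≤ j → hilbertFunction I j = 0) :
    Nonempty (MinimalGradedFreeResolution I) ∧
    ∃ a : ℕ, a + n.choose (m - 1) + 1 ≤ n * n.choose m / 2 ∧
      ∀ F : MinimalGradedFreeResolution I,
        F.betti m (m + 2) = 2 * a + 1 ∧
        F.betti (m + 1) (m + 2) = 2 * a + 1 ∧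
        F.betti 0 0 = 1 ∧
        F.betti n (n + 3) = 1 ∧
        (∀ i : ℕ, 1 ≤ i → i ≤ n - 1 →
          F.betti i (i + 1) = F.betti (n - i) ((n - i : ℕ) + 2)) ∧
        (∀ (i : ℕ) (j : ℤ), F.betti i j ≠ 0 →
          (i = 0 ∧ j = 0) ∨
          (1 ≤ i ∧ i ≤ n - 1 ∧ (j = i + 1 ∨ j = i + 2)) ∨
          (i = n ∧ j = n + 3)) ∧
        ¬ F.IsPure := by
  have : Module.Finite k (MvPolynomial (Fin n) k ⧸ I) := Module.finite_of_isArtinianRing k _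
  have hI1 : I ≠ ⊤ := by
    rintro rfl
    have := Ideal.Quotient.subsingleton_iff.2 (rfl : (⊤ : Ideal (MvPolynomial (Fin n) k)) = ⊤)
    rw [hilbertFunction, Module.finrank_zero_of_subsingleton] at h0
    exact zero_ne_one h0
  have g0 : Module.finrank k (quotientGraded I 0) = 1 := by
    simpa [h0] using finrank_quotientGraded_natCast (I := I) 0
  have g1 : Module.finrank k (quotientGraded I 1) = n := by
    simpa [h1] using finrank_quotientGraded_natCast (I := I) 1
  have g2 : Module.finrank k (quotientGraded I 2) = n := by
    simpa [h2] using finrank_quotientGraded_natCast (I := I) 2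
  have g3 : Module.finrank k (quotientGraded I 3) = 1 := by
    simpa [h3] using finrank_quotientGraded_natCast (I := I) 3
  have g4 : ∀ e : ℤ, 4 ≤ e → quotientGraded I e = ⊥ := by
    intro e he
    lift e to ℕ using by omega
    rw [← Submodule.finrank_eq_zero (R := k), finrank_quotientGraded_natCast]
    exact h4 e (by exact_mod_cast he)
  obtain ⟨φ, hφ⟩ := exists_isFrobenius hI hI1 hArt hGor g3 g4
  have h8 : 8 ≤ 2 ^ ℓ := (Nat.pow_le_pow_right two_pos hℓ : 2 ^ 3 ≤ 2 ^ ℓ)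
  have hmn : n = 2 * m + 1 := by
    have : 2 ∣ 2 ^ ℓ := dvd_pow_self 2 (by omega)
    omega
  have hm1 : 1 ≤ m := by omega
  obtain ⟨heven, hodd⟩ := parity_of_choose hℓ hn hm
  obtain ⟨r, hr, hle, hsum⟩ := koszulRank_middle g0 g1 g2 hφ hm1 hmn
  -- Parity makes the lower bound on r strict, which accounts for the extra 1 in the bound on a.
  have hne : r ≠ n.choose (m - 1) := fun h => (Nat.not_even_iff_odd.2 hodd) (h ▸ hr)
  obtain ⟨a, ha⟩ : Odd (koszulRank n (quotientGraded I) m (m + 2)) := by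
    have h := heven.mul_left n
    rw [← hsum, Nat.even_add, iff_true_right hr, Nat.even_add,
      iff_false_right (Nat.not_even_iff_odd.2 hodd), Nat.not_even_iff_odd] at h
    exact h
  refine ⟨nonempty_minimalGradedFreeResolution hI hI1, a, by omega, fun F => ?_⟩
  have hb := F.betti_eq_koszulRank hI
  have hdual : ∀ {p q : ℕ}, p + q = n → ∀ j, F.betti p j = F.betti q (n + 3 - j) := by
    intro p q hpq j
    rw [hb, hb, hφ.koszulRank_eq respectsDegrees_quotientGraded hpq]
  have hb1 : F.betti m (m + 2) = 2 * a + 1 := by rw [hb, ha]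
  have hb2 : F.betti (m + 1) (m + 2) = 2 * a + 1 := by
    rw [hdual (q := m) (by omega), ← hb1]
    congr 1
    rw [hmn]
    push_cast
    ring
  have hb0 : F.betti 0 0 = 1 := by rw [hb, koszulRank_quotientGraded_zero hI hI1, if_pos rfl]
  refine ⟨hb1, hb2, hb0, ?_, fun i hi hin => ?_, fun i j h => ?_, ?_⟩
  · rw [hdual (q := 0) (by omega), sub_self, hb0]
  · rw [hdual (q := n - i) (by omega)]
    congr 1
    push_cast [show i ≤ n by omega]
    ring
  · rw [hb] at h
    exact koszulRank_support hI hI1 g0 g1 hφ h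
  · rintro ⟨δ, hδ, h⟩
    -- The Betti numbers in homological degrees m and m + 1 are both odd, hence nonzero, in internal
    -- degree m + 2, so δ would repeat a value.
    have hδ1 : ((m : ℤ) + 2) = δ m := by
      by_contra hne
      have := h m _ hne
      omega
    have hδ2 : ((m : ℤ) + 2) = δ (m + 1) := by
      by_contra hne
      have := h (m + 1) _ hne
      omega
    exact (hδ (Nat.lt_succ_self m)).ne (hδ1.symm.trans hδ2)
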